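/- Let $\{X_{ni}\}_{n,i\ge1}$ be i.i.d. random variables with values in $\{0,1,2,\dots\}$ and generating function $A(x)=\sum_{j\ge0}a_jx^j$, and let $\{Y_n\}_{n\ge1}$ be i.i.d. random variables with values in $\{0,1,2,\dots\}$ and generating function $B(x)=\sum_{j\ge0}b_jx^j$, the two families being independent of each other. Define the Galton–Watson process with immigration by $$Z_0=0,\qquad Z_n=\sum_{i=1}^{Z_{n-1}}X_{ni}+Y_n\quad(n\ge1).$$ Assume condition (H): $0<a_0<1$, $0<b_0<1$, $\sum_{j\ge1}a_jj^2\log j<\infty$, $\sum_{j\ge1}b_jj^2<\infty$, $E(X_{11})=1$, $0<\beta:=B'(1-)<\infty$ and $0<\gamma:=\tfrac12A''(1-)<\infty$. Put $\sigma=\beta/\gamma$. Assume moreover that $E(X_{11}^{2r+\delta})<\infty$ and $E(Y_1^{r})<\infty$ for some $\delta>0$ and some $r>\max\{\sigma,1\}$. Then for every $\varepsilon>0$ there is a finite number $q(\varepsilon)\ge0$ such that $$\lim_{n\to\infty}n^{\sigma}\,P\Big\{\Big|\frac{Z_{n+1}}{Z_n}-1\Big|>\varepsilon\,\Big|\,Z_n>0\Big\}=q(\varepsilon).$$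 Moreover $q(\varepsilon)>0$ if and only if the deviation is possible at all, that is, $P\{Z_n>0,\ |Z_{n+1}/Z_n-1|>\varepsilon\}>0$ for at least one $n$; in particular $q(\varepsilon)>0$ whenever $0<\varepsilon\le1$. -/

import Mathlib

open MeasureTheory ProbabilityTheory Filter Topology

/-- The (real) generating function `x ↦ ∑ j, p j * x ^ j` of a sequence `p`. -/
noncomputable def genFun (p : ℕ → ℝ) (x : ℝ) : ℝ := ∑' j : ℕ, p j * x ^ j

/-- The point masses `j ↦ P (V = j)` of an `ℕ`-valued random variable `V`. -/
noncomputable def pointMass {Ω : Type*} [MeasurableSpace Ω] (P : Measure Ω) (V : Ω → ℕ)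
    (j : ℕ) : ℝ := P.real {ω | V ω = j}

/-- The input of a Galton-Watson process with immigration.  Indices start at `0`:
`X n i` is the number of children, in generation `n + 1`, of the `(i + 1)`-st individual of
generation `n` (usually written `X_{n+1,i+1}`), and `Y n` is the number of immigrants into
generation `n + 1` (usually written `Y_{n+1}`).  The `X n i` are i.i.d., the `Y n` are i.i.d.,
and the two families are independent of each other. -/
structure IsGWIInput {Ω : Type*} [MeasurableSpace Ω] (P : Measure Ω)
    (X : ℕ → ℕ → Ω → ℕ) (Y : ℕ → Ω → ℕ) : Prop where
  measurable_X : ∀ n i, Measurable (X n i)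
  measurable_Y : ∀ n, Measurable (Y n)
  indep_X : iIndepFun (fun p : ℕ × ℕ => X p.1 p.2) P
  indep_Y : iIndepFun Y P
  indep_XY : IndepFun (fun ω (p : ℕ × ℕ) => X p.1 p.2 ω) (fun ω (n : ℕ) => Y n ω) P
  identDistrib_X : ∀ n i, IdentDistrib (X n i) (X 0 0) P P
  identDistrib_Y : ∀ n, IdentDistrib (Y n) (Y 0) P P

/-- The Galton-Watson process with immigration, started from `0`. -/
def gwi {Ω : Type*} (X : ℕ → ℕ → Ω → ℕ) (Y : ℕ → Ω → ℕ) : ℕ → Ω → ℕ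
  | 0, _ => 0
  | n + 1, ω => (∑ i ∈ Finset.range (gwi X Y n ω), X n i ω) + Y n ω

/-- The standing assumption on the offspring law `a`, with generating function `A`, and the
immigration law `b`, with generating function `B`: both laws charge `0` but are not
concentrated there, `∑ a_j j² log j` and `∑ b_j j²` are finite, the offspring mean is `1`,
`β = B'(1-)` and `γ = A''(1-) / 2`, both finite and positive. -/
structure ConditionH {Ω : Type*} [MeasurableSpace Ω] (P : Measure Ω)
    (X : ℕ → ℕ → Ω → ℕ) (Y : ℕ → Ω → ℕ) (β γ : ℝ) : Prop where
  a_zero_pos : 0 < pointMass P (X 0 0) 0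
  a_zero_lt_one : pointMass P (X 0 0) 0 < 1
  b_zero_pos : 0 < pointMass P (Y 0) 0
  b_zero_lt_one : pointMass P (Y 0) 0 < 1
  summable_a : Summable fun j : ℕ => pointMass P (X 0 0) j * (j : ℝ) ^ 2 * Real.log j
  summable_b : Summable fun j : ℕ => pointMass P (Y 0) j * (j : ℝ) ^ 2
  mean_offspring : ∫ ω, (X 0 0 ω : ℝ) ∂P = 1
  tendsto_beta : Tendsto (deriv (genFun (pointMass P (Y 0)))) (𝓝[<] 1) (𝓝 β)
  tendsto_gamma :
    Tendsto (fun x => (1 / 2 : ℝ) * iteratedDeriv 2 (genFun (pointMass P (X 0 0))) x)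
      (𝓝[<] 1) (𝓝 γ)
  beta_pos : 0 < β
  gamma_pos : 0 < γ

/-- The event `|Z_{n+1} / Z_n - 1| > ε`; it is only used together with `Z_n > 0`. -/
def ratioDeviation {Ω : Type*} (X : ℕ → ℕ → Ω → ℕ) (Y : ℕ → Ω → ℕ) (ε : ℝ) (n : ℕ) : Set Ω :=
  {ω | ε < |(gwi X Y (n + 1) ω : ℝ) / (gwi X Y n ω : ℝ) - 1|}
open Asymptotics

/-!
Let `f_k` be the `k`-th iterate at `0` of the offspring generating function `A`. Counting the
descendants of the immigrants generation by generation shows that the law of `Z_{n+1}` is the law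
of `Z_n` convolved with another law, so `P (Z_n = k) / P (Z_n = 0)` is nondecreasing in `n` for
every `k`. Conditioning on `Z_n = k` then shows that the probability of the deviation, divided by
`P (Z_n = 0)`, is nondecreasing as well, and its supremum is positive exactly when the deviation
is possible at all. The supremum is finite: a one-step deviation from the state `k` has
probability `O (k ^ (-r))` by truncation and a Chernoff bound, `k ^ (-r)` is dominated by a
combination of the powers `f_m ^ k` with weights of order `m ^ (-(r + 1))`, and `E (f_m ^ Z_n)` is
at most `P (Z_n = 0) / P (Z_m = 0)`, which is `O (m ^ σ) * P (Z_n = 0)` with `σ < r`. Finally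
`n ^ σ * P (Z_n = 0)`, where `P (Z_n = 0)` is the product of the `B (f_k)` over `k < n`, has a
positive limit, because `1 - f_k = 1 / (γ k) + O (k ^ (-1 - η))` for some `η > 0`.
-/

open Asymptotics
open scoped ENNReal

section Series

open PowerSeries Finset.HasAntidiagonal

/-- The sum `∑ j, f_j x ^ j` of a power series with coefficients in `[0, ∞]`, which always
makes sense, so that no radius of convergence enters. -/
noncomputable def ennEval (f : PowerSeries ℝ≥0∞) (x : ℝ≥0∞) : ℝ≥0∞ :=
  ∑' j, coeff j f * x ^ j

/-- The composition `f ∘ a = ∑ k, f_k a ^ k` of power series with coefficients in `[0, ∞]`; unlike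
Mathlib's `PowerSeries.subst`, it needs no condition on the constant coefficient of `a`. -/
noncomputable def ennSubst (a f : PowerSeries ℝ≥0∞) : PowerSeries ℝ≥0∞ :=
  mk fun j => ∑' k, coeff k f * coeff j (a ^ k)

/-- The generating function of the `n`-th generation of a branching process started from `0`
whose offspring and immigration laws have the generating functions `a` and `b`. -/
noncomputable def immigrationSeries (a b : PowerSeries ℝ≥0∞) : ℕ → PowerSeries ℝ≥0∞
  | 0 => 1
  | n + 1 => ennSubst a (immigrationSeries a b n) * b

theorem coeff_mul_coeff_le_coeff_mul (f g : PowerSeries ℝ≥0∞) (i j : ℕ) :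
    coeff i f * coeff j g ≤ coeff (i + j) (f * g) := by
  rw [coeff_mul]
  exact Finset.single_le_sum (f := fun q : ℕ × ℕ => coeff q.1 f * coeff q.2 g)
    (fun _ _ => zero_le) (a := (i, j)) (by simp)

theorem coeff_pow_le_coeff_pow (f : PowerSeries ℝ≥0∞) (i k : ℕ) :
    coeff i f ^ k ≤ coeff (i * k) (f ^ k) := by
  induction k with
  | zero => simp
  | succ k ih =>
    calc coeff i f ^ (k + 1) ≤ coeff (i * k) (f ^ k) * coeff i f := by rw [pow_succ]; gcongr
      _ ≤ coeff (i * (k + 1)) (f ^ (k + 1)) := by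
        rw [pow_succ f, mul_add_one]
        exact coeff_mul_coeff_le_coeff_mul _ _ _ _

theorem tsum_tsum_eq_tsum_sum_antidiagonal (u : ℕ → ℕ → ℝ≥0∞) :
    ∑' i, ∑' j, u i j = ∑' n, ∑ p ∈ antidiagonal n, u p.1 p.2 := by
  rw [← ENNReal.tsum_prod, ← (sigmaAntidiagonalEquivProd (A := ℕ)).tsum_eq, ENNReal.tsum_sigma']
  refine tsum_congr fun n => ?_
  simp only [sigmaAntidiagonalEquivProd_apply]
  exact Finset.tsum_subtype (antidiagonal n) fun p : ℕ × ℕ => u p.1 p.2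

@[simp]
theorem ennEval_zero (f : PowerSeries ℝ≥0∞) : ennEval f 0 = coeff 0 f := by
  rw [ennEval, tsum_eq_single 0 fun j hj => by simp [hj], pow_zero, mul_one]

theorem ennEval_one (x : ℝ≥0∞) : ennEval 1 x = 1 := by
  rw [ennEval, tsum_eq_single 0 fun j hj => by simp [coeff_one, hj]]
  simp

theorem ennEval_mul (f g : PowerSeries ℝ≥0∞) (x : ℝ≥0∞) :
    ennEval (f * g) x = ennEval f x * ennEval g x := by
  simp only [ennEval, coeff_mul]
  simp_rw [← ENNReal.tsum_mul_right, ← ENNReal.tsum_mul_left]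
  rw [tsum_tsum_eq_tsum_sum_antidiagonal]
  refine tsum_congr fun n => ?_
  rw [Finset.sum_mul]
  refine Finset.sum_congr rfl fun p hp => ?_
  rw [← mem_antidiagonal.mp hp, pow_add]
  ring

theorem ennEval_pow (f : PowerSeries ℝ≥0∞) (x : ℝ≥0∞) (k : ℕ) :
    ennEval (f ^ k) x = ennEval f x ^ k := by
  induction k with
  | zero => rw [pow_zero, pow_zero, ennEval_one]
  | succ k ih => rw [pow_succ, ennEval_mul, ih, pow_succ]

theorem ennEval_ennSubst (a f : PowerSeries ℝ≥0∞) (x : ℝ≥0∞) :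
    ennEval (ennSubst a f) x = ennEval f (ennEval a x) := by
  rw [ennEval.eq_def f]
  simp_rw [← ennEval_pow, ennEval, ennSubst, coeff_mk, ← ENNReal.tsum_mul_right]
  rw [ENNReal.tsum_comm]
  simp_rw [mul_assoc, ENNReal.tsum_mul_left]

theorem ennSubst_one (a : PowerSeries ℝ≥0∞) : ennSubst a 1 = 1 := by
  ext j
  rw [ennSubst, coeff_mk, tsum_eq_single 0 fun k hk => by simp [coeff_one, hk]]
  simp

theorem ennSubst_mul (a f g : PowerSeries ℝ≥0∞) :
    ennSubst a (f * g) = ennSubst a f * ennSubst a g := by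
  ext j
  have h_product : ∀ p : ℕ × ℕ,
      (∑' k, coeff k f * coeff p.1 (a ^ k)) * (∑' l, coeff l g * coeff p.2 (a ^ l)) =
        ∑' m, ∑ q ∈ antidiagonal m,
          coeff q.1 f * coeff p.1 (a ^ q.1) * (coeff q.2 g * coeff p.2 (a ^ q.2)) := fun p => by
    rw [← tsum_tsum_eq_tsum_sum_antidiagonal fun k l =>
      coeff k f * coeff p.1 (a ^ k) * (coeff l g * coeff p.2 (a ^ l)), ← ENNReal.tsum_mul_right]
    simp_rw [← ENNReal.tsum_mul_left]
  simp only [coeff_mul, ennSubst, coeff_mk, h_product]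
  rw [← Summable.tsum_finsetSum fun _ _ => ENNReal.summable]
  refine tsum_congr fun m => ?_
  rw [Finset.sum_comm, Finset.sum_mul]
  refine Finset.sum_congr rfl fun q hq => ?_
  rw [← mem_antidiagonal.mp hq, pow_add, coeff_mul, Finset.mul_sum]
  exact Finset.sum_congr rfl fun p _ => mul_mul_mul_comm _ _ _ _

variable (a b : PowerSeries ℝ≥0∞)

/-- Iterating the recursion from the other end: the factor `b ∘ a ∘ ⋯ ∘ a` is the generating
function of the descendants of the oldest immigrants. -/
theorem immigrationSeries_succ_eq_mul (n : ℕ) :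
    immigrationSeries a b (n + 1) = immigrationSeries a b n * (ennSubst a)^[n] b := by
  induction n with
  | zero => simp [immigrationSeries, ennSubst_one]
  | succ n ih =>
    rw [immigrationSeries, ih, ennSubst_mul, mul_right_comm, ← immigrationSeries, ← ih,
      Function.iterate_succ_apply']

theorem ennEval_iterate_ennSubst (n : ℕ) (x : ℝ≥0∞) :
    ennEval ((ennSubst a)^[n] b) x = ennEval b ((ennEval a)^[n] x) := by
  induction n generalizing x with
  | zero => rfl
  | succ n ih =>
    rw [Function.iterate_succ_apply', ennEval_ennSubst, ih, Function.iterate_succ_apply]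

theorem ennEval_immigrationSeries (n : ℕ) (x : ℝ≥0∞) :
    ennEval (immigrationSeries a b n) x =
      ∏ k ∈ Finset.range n, ennEval b ((ennEval a)^[k] x) := by
  induction n with
  | zero => exact ennEval_one x
  | succ n ih =>
    rw [immigrationSeries_succ_eq_mul, ennEval_mul, ih, ennEval_iterate_ennSubst,
      Finset.prod_range_succ]

theorem coeff_zero_immigrationSeries_add (m n : ℕ) :
    coeff 0 (immigrationSeries a b (m + n)) =
      coeff 0 (immigrationSeries a b m) *
        ennEval (immigrationSeries a b n) ((ennEval a)^[m] 0) := by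
  simp_rw [← ennEval_zero, ennEval_immigrationSeries, Finset.prod_range_add, add_comm m,
    Function.iterate_add_apply]

theorem coeff_immigrationSeries_mul_coeff_zero_le (n j : ℕ) :
    coeff j (immigrationSeries a b n) * coeff 0 (immigrationSeries a b (n + 1)) ≤
      coeff j (immigrationSeries a b (n + 1)) * coeff 0 (immigrationSeries a b n) := by
  rw [immigrationSeries_succ_eq_mul, ← ennEval_zero (_ * _), ennEval_mul]
  simp only [ennEval_zero]
  rw [mul_left_comm, mul_comm _ (coeff 0 (immigrationSeries a b n))]
  gcongr
  exact coeff_mul_coeff_le_coeff_mul _ _ j 0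

theorem tsum_coeff_mul_le_tsum_mul_ennEval (f : PowerSeries ℝ≥0∞) {φ w x : ℕ → ℝ≥0∞}
    (hφ : ∀ k, φ k ≤ ∑' m, w m * x m ^ k) :
    ∑' k, coeff k f * φ k ≤ ∑' m, w m * ennEval f (x m) := by
  calc ∑' k, coeff k f * φ k ≤ ∑' (k) (m), coeff k f * (w m * x m ^ k) := by
        simp only [ENNReal.tsum_mul_left]
        gcongr with k
        exact hφ k
    _ = ∑' m, w m * ennEval f (x m) := by
        rw [ENNReal.tsum_comm]
        simp only [ennEval, ← ENNReal.tsum_mul_left, mul_left_comm]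

end Series

section Law

variable {Ω Ω' : Type*} [MeasurableSpace Ω] [MeasurableSpace Ω'] {P : Measure Ω} {P' : Measure Ω'}

/-- The generating function `∑ j, P (V = j) x ^ j` of an `ℕ`-valued random variable `V`, as a
formal power series. -/
noncomputable def lawSeries (P : Measure Ω) (V : Ω → ℕ) : PowerSeries ℝ≥0∞ :=
  PowerSeries.mk fun j => P (V ⁻¹' {j})

@[simp]
theorem coeff_lawSeries (P : Measure Ω) (V : Ω → ℕ) (j : ℕ) :
    PowerSeries.coeff j (lawSeries P V) = P (V ⁻¹' {j}) :=
  PowerSeries.coeff_mk _ _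

theorem identDistrib_of_lawSeries_eq {U : Ω → ℕ} {V : Ω' → ℕ} (hU : Measurable U)
    (hV : Measurable V) (h : lawSeries P U = lawSeries P' V) : IdentDistrib U V P P' where
  aemeasurable_fst := hU.aemeasurable
  aemeasurable_snd := hV.aemeasurable
  map_eq := Measure.ext_of_singleton fun j => by
    rw [Measure.map_apply hU (measurableSet_singleton j),
      Measure.map_apply hV (measurableSet_singleton j), ← coeff_lawSeries, h, coeff_lawSeries]

theorem lawSeries_eq_of_identDistrib {U : Ω → ℕ} {V : Ω' → ℕ} (h : IdentDistrib U V P P') :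
    lawSeries P U = lawSeries P' V := by
  ext j
  simp only [coeff_lawSeries, h.measure_preimage_eq (measurableSet_singleton j)]

theorem measure_eq_tsum_preimage_singleton_inter {V : Ω → ℕ} (hV : Measurable V) (s : Set Ω) :
    P s = ∑' k, P (V ⁻¹' {k} ∩ s) := by
  have h_univ : (⋃ k, V ⁻¹' {k}) = Set.univ := by ext; simp
  rw [← Measure.restrict_apply_univ s, ← h_univ, measure_iUnion
    (fun i j hij => Disjoint.preimage V (Set.disjoint_singleton.mpr hij))
    fun k => hV (measurableSet_singleton k)]
  exact tsum_congr fun k => Measure.restrict_apply (hV (measurableSet_singleton k))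

theorem lawSeries_const_zero [IsProbabilityMeasure P] : lawSeries P (fun _ => 0) = 1 := by
  ext j
  rcases eq_or_ne j 0 with rfl | hj
  · simp
  · simp [PowerSeries.coeff_one, hj, Set.preimage_const_of_notMem, Ne.symm hj]

theorem lawSeries_add {U V : Ω → ℕ} (hU : Measurable U) (hV : Measurable V)
    (h : IndepFun U V P) : lawSeries P (fun ω => U ω + V ω) = lawSeries P U * lawSeries P V := by
  ext j
  have h_union : (fun ω => U ω + V ω) ⁻¹' {j} = ⋃ q ∈ Finset.HasAntidiagonal.antidiagonal j,
      U ⁻¹' {q.1} ∩ V ⁻¹' {q.2} := by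
    ext ω; simp
  rw [PowerSeries.coeff_mul, coeff_lawSeries, h_union, measure_biUnion_finset]
  · simp only [coeff_lawSeries]
    exact Finset.sum_congr rfl fun q _ =>
      h.measure_inter_preimage_eq_mul _ _ (measurableSet_singleton _) (measurableSet_singleton _)
  · rintro q - q' - hqq
    refine Set.disjoint_left.mpr ?_
    rintro ω ⟨hU, hV⟩ ⟨hU', hV'⟩
    exact hqq (Prod.ext (hU.symm.trans hU') (hV.symm.trans hV'))
  · exact fun q _ => (hU (measurableSet_singleton _)).inter (hV (measurableSet_singleton _))

theorem lawSeries_sum_range [IsProbabilityMeasure P] {U : ℕ → Ω → ℕ}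
    (hm : ∀ i, Measurable (U i)) (hi : iIndepFun U P)
    (hU : ∀ i, IdentDistrib (U i) (U 0) P P) (k : ℕ) :
    lawSeries P (fun ω => ∑ i ∈ Finset.range k, U i ω) = lawSeries P (U 0) ^ k := by
  induction k with
  | zero => exact lawSeries_const_zero
  | succ k ih =>
    have h_indep : IndepFun (fun ω => ∑ i ∈ Finset.range k, U i ω) (U k) P := by
      simpa only [← Finset.sum_apply] using hi.indepFun_sum_range_succ hm k
    simp_rw [Finset.sum_range_succ]
    rw [lawSeries_add (Finset.measurable_sum _ fun i _ => hm i) (hm k) h_indep, ih,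
      lawSeries_eq_of_identDistrib (hU k), pow_succ]

theorem iIndepFun_sumElim {ι κ β : Type*} [MeasurableSpace β] {X : ι → Ω → β} {Y : κ → Ω → β}
    (hX : iIndepFun X P) (hY : iIndepFun Y P)
    (hXY : IndepFun (fun ω i => X i ω) (fun ω k => Y k ω) P) :
    iIndepFun (Sum.elim X Y : ι ⊕ κ → Ω → β) P := by
  rw [iIndepFun_iff_measure_inter_preimage_eq_mul]
  intro S sets hS
  have hleft : ∀ i ∈ S.toLeft, MeasurableSet (sets (Sum.inl i)) :=
    fun i hi => hS _ (Finset.mem_toLeft.mp hi)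
  have hright : ∀ k ∈ S.toRight, MeasurableSet (sets (Sum.inr k)) :=
    fun k hk => hS _ (Finset.mem_toRight.mp hk)
  have hblocks := hXY.measure_inter_preimage_eq_mul _ _
    (S.toLeft.measurableSet_biInter fun i hi => measurable_pi_apply i (hleft i hi))
    (S.toRight.measurableSet_biInter fun k hk => measurable_pi_apply k (hright k hk))
  simp only [Set.preimage_iInter, ← Set.preimage_comp] at hblocks
  calc P (⋂ i ∈ S, (Sum.elim X Y : ι ⊕ κ → Ω → β) i ⁻¹' sets i)
      = P ((⋂ i ∈ S.toLeft, X i ⁻¹' sets (Sum.inl i)) ∩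
          ⋂ k ∈ S.toRight, Y k ⁻¹' sets (Sum.inr k)) := by
        congr 1
        ext ω
        simp [Set.mem_iInter]
    _ = (∏ i ∈ S.toLeft, P (X i ⁻¹' sets (Sum.inl i))) *
          ∏ k ∈ S.toRight, P (Y k ⁻¹' sets (Sum.inr k)) := by
        rw [← hX.measure_inter_preimage_eq_mul _ hleft, ← hY.measure_inter_preimage_eq_mul _ hright]
        exact hblocks
    _ = ∏ i ∈ S, P ((Sum.elim X Y : ι ⊕ κ → Ω → β) i ⁻¹' sets i) := by
        conv_rhs => rw [← Finset.toLeft_disjSum_toRight (u := S), Finset.prod_disjSum]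
        rfl

end Law

section Generations

variable {Ω : Type*} {X : ℕ → ℕ → Ω → ℕ} {Y : ℕ → Ω → ℕ}

/-- The size of generation `n + 1` when generation `n` has exactly `k` members. -/
def nextGen (X : ℕ → ℕ → Ω → ℕ) (Y : ℕ → Ω → ℕ) (n k : ℕ) (ω : Ω) : ℕ :=
  ∑ i ∈ Finset.range k, X n i ω + Y n ω

theorem gwi_succ_apply (n : ℕ) (ω : Ω) :
    gwi X Y (n + 1) ω = nextGen X Y n (gwi X Y n ω) ω := rfl

/-- The σ-algebra `m` is arbitrary because it will be the one generated by the inputs of the first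
`n` steps. -/
theorem measurable_gwi_of_forall_lt {m : MeasurableSpace Ω} (n : ℕ)
    (hX : ∀ k < n, ∀ i, Measurable[m] (X k i)) (hY : ∀ k < n, Measurable[m] (Y k)) :
    Measurable[m] (gwi X Y n) := by
  induction n with
  | zero => exact measurable_const
  | succ n ih =>
    have hZ := ih (fun k hk => hX k (by omega)) (fun k hk => hY k (by omega))
    have h_next : Measurable[m] fun ω => (gwi X Y n ω, fun k => nextGen X Y n k ω) :=
      hZ.prodMk (measurable_pi_lambda _ fun k =>
        (Finset.measurable_sum _ fun i _ => hX n n.lt_succ_self i).add (hY n n.lt_succ_self))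
    have h_eval : Measurable fun q : ℕ × (ℕ → ℕ) => q.2 q.1 :=
      measurable_from_prod_countable_right fun k => measurable_pi_apply k
    exact h_eval.comp h_next

namespace IsGWIInput

variable [MeasurableSpace Ω] {P : Measure Ω} (h : IsGWIInput P X Y)
include h

theorem isProbabilityMeasure : IsProbabilityMeasure P := h.indep_X.isProbabilityMeasure

theorem iIndepFun_offspring (n : ℕ) : iIndepFun (X n) P :=
  h.indep_X.precomp (g := fun i => (n, i)) fun _ _ hij => (Prod.mk.inj hij).2

theorem measurable_gwi (n : ℕ) : Measurable (gwi X Y n) :=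
  measurable_gwi_of_forall_lt n (fun k _ i => h.measurable_X k i) fun k _ => h.measurable_Y k

theorem measurable_nextGen (n k : ℕ) : Measurable (nextGen X Y n k) :=
  (Finset.measurable_sum _ fun i _ => h.measurable_X n i).add (h.measurable_Y n)

theorem lawSeries_nextGen (n k : ℕ) :
    lawSeries P (nextGen X Y n k) = lawSeries P (X 0 0) ^ k * lawSeries P (Y 0) := by
  have := h.isProbabilityMeasure
  have h_indep : IndepFun (fun ω => ∑ i ∈ Finset.range k, X n i ω) (Y n) P :=
    h.indep_XY.comp (φ := fun f : ℕ × ℕ → ℕ => ∑ i ∈ Finset.range k, f (n, i))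
      (ψ := fun f : ℕ → ℕ => f n) (Finset.measurable_sum _ fun i _ => measurable_pi_apply _)
      (measurable_pi_apply n)
  unfold nextGen
  rw [lawSeries_add (Finset.measurable_sum _ fun i _ => h.measurable_X n i)
    (h.measurable_Y n) h_indep, lawSeries_eq_of_identDistrib (h.identDistrib_Y n),
    lawSeries_sum_range (h.measurable_X n) (h.iIndepFun_offspring n) fun i =>
      (h.identDistrib_X n i).trans (h.identDistrib_X n 0).symm,
    lawSeries_eq_of_identDistrib (h.identDistrib_X n 0)]

theorem identDistrib_nextGen (n k : ℕ) :
    IdentDistrib (nextGen X Y n k) (nextGen X Y 0 k) P P :=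
  identDistrib_of_lawSeries_eq (h.measurable_nextGen n k) (h.measurable_nextGen 0 k)
    (by rw [h.lawSeries_nextGen, h.lawSeries_nextGen])

theorem indepFun_gwi_nextGen (n k : ℕ) : IndepFun (gwi X Y n) (nextGen X Y n k) P := by
  let W : (ℕ × ℕ) ⊕ ℕ → Ω → ℕ := Sum.elim (fun p : ℕ × ℕ => X p.1 p.2) Y
  let step : (ℕ × ℕ) ⊕ ℕ → ℕ := Sum.elim Prod.fst id
  let σ (S : Set ((ℕ × ℕ) ⊕ ℕ)) : MeasurableSpace Ω := ⨆ i ∈ S, MeasurableSpace.comap (W i) ⊤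
  have hW : iIndepFun W P := iIndepFun_sumElim h.indep_X h.indep_Y h.indep_XY
  have hWm : ∀ i, Measurable (W i) := by
    rintro (p | m)
    · exact h.measurable_X _ _
    · exact h.measurable_Y _
  have hσ : ∀ S, ∀ i ∈ S, Measurable[σ S] (W i) := fun S i hi =>
    (comap_measurable (W i)).mono
      (le_iSup₂ (f := fun i (_ : i ∈ S) => MeasurableSpace.comap (W i) ⊤) i hi) le_rfl
  have h_indep : Indep (σ {i | step i < n}) (σ {i | step i = n}) P :=
    indep_iSup_of_disjoint (fun i => (hWm i).comap_le) hW.iIndep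
      (Set.disjoint_left.mpr fun _ hlt heq => hlt.ne heq)
  rw [IndepFun_iff_Indep]
  refine indep_of_indep_of_le_left (indep_of_indep_of_le_right h_indep ?_) ?_
  · exact ((Finset.measurable_sum _ fun i _ => hσ {i | step i = n} (Sum.inl (n, i)) rfl).add
      (hσ {i | step i = n} (Sum.inr n) rfl)).comap_le
  · exact (measurable_gwi_of_forall_lt n
      (fun k hk i => hσ {i | step i < n} (Sum.inl (k, i)) hk)
      fun k hk => hσ {i | step i < n} (Sum.inr k) hk).comap_le

theorem measure_gwi_inter_gwi_succ (n k : ℕ) (s : Set ℕ) :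
    P (gwi X Y n ⁻¹' {k} ∩ gwi X Y (n + 1) ⁻¹' s) =
      P (gwi X Y n ⁻¹' {k}) * P (nextGen X Y 0 k ⁻¹' s) := by
  have h_event : gwi X Y n ⁻¹' {k} ∩ gwi X Y (n + 1) ⁻¹' s =
      gwi X Y n ⁻¹' {k} ∩ nextGen X Y n k ⁻¹' s := by
    ext ω
    simp only [Set.mem_inter_iff, Set.mem_preimage, gwi_succ_apply]
    exact and_congr_right fun hk => by rw [Set.mem_singleton_iff.mp hk]
  rw [h_event, (h.indepFun_gwi_nextGen n k).measure_inter_preimage_eq_mul _ _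
    (measurableSet_singleton k) MeasurableSet.of_discrete,
    (h.identDistrib_nextGen n k).measure_preimage_eq MeasurableSet.of_discrete]

theorem lawSeries_gwi (n : ℕ) :
    lawSeries P (gwi X Y n) = immigrationSeries (lawSeries P (X 0 0)) (lawSeries P (Y 0)) n := by
  have := h.isProbabilityMeasure
  induction n with
  | zero => exact lawSeries_const_zero
  | succ n ih =>
    ext j
    rw [immigrationSeries, ← ih, coeff_lawSeries,
      measure_eq_tsum_preimage_singleton_inter (h.measurable_gwi n), PowerSeries.coeff_mul]
    simp_rw [ennSubst, PowerSeries.coeff_mk, ← ENNReal.tsum_mul_right]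
    rw [← Summable.tsum_finsetSum fun _ _ => ENNReal.summable]
    refine tsum_congr fun k => ?_
    rw [h.measure_gwi_inter_gwi_succ, ← coeff_lawSeries P (nextGen X Y 0 k), h.lawSeries_nextGen,
      PowerSeries.coeff_mul, Finset.mul_sum, coeff_lawSeries]
    exact Finset.sum_congr rfl fun q _ => (mul_assoc _ _ _).symm

end IsGWIInput

end Generations

section Taylor

theorem le_rpow_add_of_le_pow_of_le_pow_succ {x s η : ℝ} {m : ℕ} (hs : 0 ≤ s)
    (hη : η ∈ Set.Icc 0 1) (h : x ≤ s ^ m) (h' : x ≤ s ^ (m + 1)) : x ≤ s ^ (m + η) := by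
  rcases hs.eq_or_lt with rfl | hs
  · exact (h'.trans_eq (zero_pow m.succ_ne_zero)).trans (Real.rpow_nonneg le_rfl _)
  rw [← Real.rpow_natCast] at h h'
  rcases le_total s 1 with h1 | h1
  · exact h'.trans (Real.rpow_le_rpow_of_exponent_ge hs h1 (by push_cast; linarith [hη.2]))
  · exact h.trans (Real.rpow_le_rpow_of_exponent_le h1 (by linarith [hη.1]))

theorem natCast_mul_sub_one_nonneg (j : ℕ) : (0 : ℝ) ≤ j * (j - 1) := by
  rcases j with _ | j
  · simp
  · push_cast; rw [add_sub_cancel_right]; positivity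

theorem one_sub_pow_taylor_one_succ (t : ℝ) (j : ℕ) :
    (1 - t) ^ (j + 1) - 1 + ((j + 1 : ℕ) : ℝ) * t =
      ((1 - t) ^ j - 1 + j * t) * (1 - t) + j * t ^ 2 := by
  push_cast; ring

variable {t : ℝ} (ht0 : 0 ≤ t) (ht1 : t ≤ 1) (j : ℕ)

section
include ht1

theorem one_sub_pow_taylor_one_nonneg : 0 ≤ (1 - t) ^ j - 1 + j * t := by
  have h_bernoulli := one_add_mul_le_pow (a := -t) (by linarith) j
  rw [← sub_eq_add_neg] at h_bernoulli
  linarith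

theorem sq_le_one_sub_pow_taylor_one {j : ℕ} (hj : 2 ≤ j) :
    t ^ 2 ≤ (1 - t) ^ j - 1 + j * t := by
  obtain ⟨i, rfl⟩ := Nat.exists_eq_add_of_le' (one_le_two.trans hj)
  have hi : (1 : ℝ) ≤ i := by exact_mod_cast Nat.le_of_succ_le_succ hj
  rw [one_sub_pow_taylor_one_succ]
  nlinarith [mul_nonneg (one_sub_pow_taylor_one_nonneg ht1 i) (sub_nonneg.mpr ht1),
    mul_nonneg (sub_nonneg.mpr hi) (sq_nonneg t)]

end

section
include ht0 ht1

theorem one_sub_pow_taylor_one_le_sq : (1 - t) ^ j - 1 + j * t ≤ (j * t) ^ 2 := by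
  induction j with
  | zero => simp
  | succ j ih =>
    have h_contract := mul_le_of_le_one_right (one_sub_pow_taylor_one_nonneg ht1 j)
      (show 1 - t ≤ 1 by linarith)
    rw [one_sub_pow_taylor_one_succ]
    push_cast
    nlinarith [mul_nonneg j.cast_nonneg (sq_nonneg t), sq_nonneg t]

theorem abs_one_sub_pow_taylor_one_le_rpow {η : ℝ} (hη : η ∈ Set.Icc 0 1) :
    |(1 - t) ^ j - 1 + j * t| ≤ (j * t) ^ (1 + η) := by
  rw [abs_of_nonneg (one_sub_pow_taylor_one_nonneg ht1 j)]
  have h_le : (1 - t) ^ j - 1 + j * t ≤ (j * t) ^ 1 := by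
    linarith [pow_le_one₀ (n := j) (sub_nonneg.mpr ht1) (by linarith)]
  exact_mod_cast le_rpow_add_of_le_pow_of_le_pow_succ (by positivity) hη h_le
    (one_sub_pow_taylor_one_le_sq ht0 ht1 j)

theorem abs_one_sub_pow_taylor_two_le_sq :
    |(1 - t) ^ j - 1 + j * t - j * (j - 1) / 2 * t ^ 2| ≤ (j * t) ^ 2 := by
  have h0 := one_sub_pow_taylor_one_nonneg ht1 j
  have h2 := one_sub_pow_taylor_one_le_sq ht0 ht1 j
  have h_quad : 0 ≤ (j : ℝ) * (j - 1) / 2 * t ^ 2 := by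
    have := natCast_mul_sub_one_nonneg j
    positivity
  have h_quad_le : (j : ℝ) * (j - 1) / 2 * t ^ 2 ≤ (j * t) ^ 2 := by
    nlinarith [mul_nonneg j.cast_nonneg (sq_nonneg t), sq_nonneg (j * t)]
  exact abs_le.mpr ⟨by linarith, by linarith⟩

theorem abs_one_sub_pow_taylor_two_le_cube :
    |(1 - t) ^ j - 1 + j * t - j * (j - 1) / 2 * t ^ 2| ≤ (j * t) ^ 3 := by
  induction j with
  | zero => simp
  | succ j ih =>
    have h_step : |t * ((1 - t) ^ j - 1 + j * t)| ≤ t * (j * t) ^ 2 := by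
      rw [abs_of_nonneg (mul_nonneg ht0 (one_sub_pow_taylor_one_nonneg ht1 j))]
      exact mul_le_mul_of_nonneg_left (one_sub_pow_taylor_one_le_sq ht0 ht1 j) ht0
    calc |(1 - t) ^ (j + 1) - 1 + ((j + 1 : ℕ) : ℝ) * t -
          ((j + 1 : ℕ) : ℝ) * (((j + 1 : ℕ) : ℝ) - 1) / 2 * t ^ 2|
        = |((1 - t) ^ j - 1 + j * t - j * (j - 1) / 2 * t ^ 2) -
            t * ((1 - t) ^ j - 1 + j * t)| := by push_cast; ring_nf
      _ ≤ (j * t) ^ 3 + t * (j * t) ^ 2 := (abs_sub _ _).trans (add_le_add ih h_step)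
      _ = (j ^ 3 + j ^ 2) * t ^ 3 := by ring
      _ ≤ (((j + 1 : ℕ) : ℝ) * t) ^ 3 := by
        rw [mul_pow]
        gcongr
        push_cast
        nlinarith [mul_nonneg j.cast_nonneg (j.cast_nonneg (α := ℝ)), j.cast_nonneg (α := ℝ)]

theorem abs_one_sub_pow_taylor_two_le_rpow {η : ℝ} (hη : η ∈ Set.Icc 0 1) :
    |(1 - t) ^ j - 1 + j * t - j * (j - 1) / 2 * t ^ 2| ≤ (j * t) ^ (2 + η) := by
  rw [← Nat.cast_two]
  exact le_rpow_add_of_le_pow_of_le_pow_succ (by positivity) hη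
    (abs_one_sub_pow_taylor_two_le_sq ht0 ht1 j) (abs_one_sub_pow_taylor_two_le_cube ht0 ht1 j)

end

end Taylor

section GenFun

variable {a : ℕ → ℝ}

theorem summable_mul_pow_of_nonneg (h0 : ∀ j, 0 ≤ a j) (ha : Summable a) {x : ℝ} (hx0 : 0 ≤ x)
    (hx1 : x ≤ 1) : Summable fun j => a j * x ^ j :=
  ha.of_nonneg_of_le (fun j => mul_nonneg (h0 j) (pow_nonneg hx0 j))
    fun j => mul_le_of_le_one_right (h0 j) (pow_le_one₀ hx0 hx1)

section Taylor

variable {S m v M η t : ℝ} (h0 : ∀ j, 0 ≤ a j) (hS : HasSum a S)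
  (hm : HasSum (fun j => a j * (j : ℝ)) m) (ht0 : 0 ≤ t) (ht1 : t ≤ 1)
include h0 hS hm ht0 ht1

theorem hasSum_genFun_taylor_one :
    HasSum (fun j => a j * ((1 - t) ^ j - 1 + j * t)) (genFun a (1 - t) - S + m * t) := by
  have h_pow := summable_mul_pow_of_nonneg h0 hS.summable (x := 1 - t) (by linarith) (by linarith)
  refine ((h_pow.hasSum.sub hS).add (hm.mul_right t)).congr_fun fun j => ?_
  ring

theorem abs_genFun_taylor_one_le (hη : η ∈ Set.Icc 0 1)
    (hM : HasSum (fun j => a j * (j : ℝ) ^ (1 + η)) M) :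
    |genFun a (1 - t) - S + m * t| ≤ M * t ^ (1 + η) := by
  refine (hasSum_genFun_taylor_one h0 hS hm ht0 ht1).norm_le_of_bounded
    (hM.mul_right (t ^ (1 + η))) fun j => ?_
  rw [norm_mul, Real.norm_of_nonneg (h0 j), mul_assoc, ← Real.mul_rpow j.cast_nonneg ht0]
  exact mul_le_mul_of_nonneg_left (abs_one_sub_pow_taylor_one_le_rpow ht0 ht1 j hη) (h0 j)

theorem abs_genFun_taylor_two_le (hv : HasSum (fun j => a j * (j * (j - 1) / 2)) v)
    (hη : η ∈ Set.Icc 0 1) (hM : HasSum (fun j => a j * (j : ℝ) ^ (2 + η)) M) :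
    |genFun a (1 - t) - S + m * t - v * t ^ 2| ≤ M * t ^ (2 + η) := by
  refine ((hasSum_genFun_taylor_one h0 hS hm ht0 ht1).sub
    (hv.mul_right (t ^ 2))).norm_le_of_bounded (hM.mul_right (t ^ (2 + η))) fun j => ?_
  rw [mul_assoc (a j) (_ / 2), ← mul_sub, norm_mul, Real.norm_of_nonneg (h0 j), mul_assoc,
    ← Real.mul_rpow j.cast_nonneg ht0]
  exact mul_le_mul_of_nonneg_left (abs_one_sub_pow_taylor_two_le_rpow ht0 ht1 j hη) (h0 j)

end Taylor

theorem hasDerivAt_genFun (ha : Summable fun j => |a j| * (j : ℝ)) {x : ℝ} (hx : |x| < 1) :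
    HasDerivAt (genFun a) (genFun (fun j => a (j + 1) * ((j : ℝ) + 1)) x) x := by
  have h_bound : ∀ j, ∀ y ∈ Metric.ball (0 : ℝ) 1, ‖a j * (j * y ^ (j - 1))‖ ≤ |a j| * j := by
    intro j y hy
    rw [norm_mul, norm_mul, Real.norm_natCast, norm_pow, Real.norm_eq_abs]
    exact mul_le_mul_of_nonneg_left (mul_le_of_le_one_right j.cast_nonneg
      (pow_le_one₀ (norm_nonneg y) (mem_ball_zero_iff.mp hy).le)) (abs_nonneg _)
  have hx : x ∈ Metric.ball (0 : ℝ) 1 := mem_ball_zero_iff.mpr hx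
  have h_deriv := hasDerivAt_tsum_of_isPreconnected (g := fun j x => a j * x ^ j) ha
    Metric.isOpen_ball (convex_ball (0 : ℝ) 1).isPreconnected
    (fun j y _ => (hasDerivAt_pow j y).const_mul (a j)) h_bound (Metric.mem_ball_self one_pos)
    (summable_of_ne_finset_zero (s := {0}) fun j hj => by
      simp [Finset.notMem_singleton.mp hj]) hx
  refine h_deriv.congr_deriv ?_
  rw [(ha.of_norm_bounded fun j => h_bound j x hx).tsum_eq_zero_add]
  simp [genFun, mul_assoc]

theorem tendsto_genFun_nhdsLT_one {S : ℝ} (ha : HasSum a S) :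
    Tendsto (genFun a) (𝓝[<] 1) (𝓝 S) :=
  Real.tendsto_tsum_powerSeries_nhdsWithin_lt ha.tendsto_sum_nat

theorem eventually_abs_lt_one : ∀ᶠ x : ℝ in 𝓝[<] 1, |x| < 1 := by
  filter_upwards [Ioo_mem_nhdsLT (zero_lt_one' ℝ)] with x hx
  exact (abs_of_pos hx.1).trans_lt hx.2

theorem tendsto_deriv_genFun {m : ℝ} (h0 : ∀ j, 0 ≤ a j)
    (hm : HasSum (fun j => a j * (j : ℝ)) m) : Tendsto (deriv (genFun a)) (𝓝[<] 1) (𝓝 m) := by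
  have h_shift : HasSum (fun j => a (j + 1) * ((j : ℝ) + 1)) m := by
    simpa using (hasSum_nat_add_iff' 1).mpr hm
  refine (tendsto_genFun_nhdsLT_one h_shift).congr' ?_
  filter_upwards [eventually_abs_lt_one] with x hx
  exact (hasDerivAt_genFun (by simpa only [abs_of_nonneg (h0 _)] using hm.summable) hx).deriv.symm

theorem tendsto_iteratedDeriv_two_genFun {m v : ℝ} (h0 : ∀ j, 0 ≤ a j)
    (hm : HasSum (fun j => a j * (j : ℝ)) m) (hv : HasSum (fun j => a j * (j * (j - 1))) v) :
    Tendsto (iteratedDeriv 2 (genFun a)) (𝓝[<] 1) (𝓝 v) := by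
  have h_shift : HasSum (fun j => a (j + 1) * ((j : ℝ) + 1) * j) v := by
    simpa [mul_assoc] using (hasSum_nat_add_iff' 1).mpr hv
  refine (tendsto_deriv_genFun (fun j => mul_nonneg (h0 _) (by positivity)) h_shift).congr' ?_
  filter_upwards [eventually_abs_lt_one] with x hx
  rw [iteratedDeriv_succ, iteratedDeriv_one]
  refine Filter.EventuallyEq.deriv_eq ?_
  filter_upwards [continuous_abs.continuousAt.eventually_lt_const hx] with y hy
  exact (hasDerivAt_genFun (by simpa only [abs_of_nonneg (h0 _)] using hm.summable) hy).deriv.symm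

end GenFun

section Recursion

theorem inv_add_mul_le_inv_of_le_sub_sq {t : ℕ → ℝ} {c : ℝ} (hpos : ∀ k, 0 < t k) (hc : 0 < c)
    (hle : ∀ k, t (k + 1) ≤ t k - c * t k ^ 2) (k : ℕ) : (t 0)⁻¹ + c * k ≤ (t k)⁻¹ := by
  induction k with
  | zero => simp
  | succ k ih =>
    have hk := hpos k
    have h_step : t (k + 1) * ((t k)⁻¹ + c) ≤ 1 := calc
      t (k + 1) * ((t k)⁻¹ + c) ≤ (t k - c * t k ^ 2) * ((t k)⁻¹ + c) := by
        gcongr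
        exact hle k
      _ = 1 - (c * t k) ^ 2 := by field_simp; ring
      _ ≤ 1 := sub_le_self _ (sq_nonneg _)
    have h_inv : (t k)⁻¹ + c ≤ (t (k + 1))⁻¹ := by
      rwa [← one_div (t (k + 1)), le_div_iff₀' (hpos _)]
    push_cast
    linarith

variable {t y : ℕ → ℝ} {β γ η : ℝ}

theorem log_one_sub_add_isBigO {u : ℕ → ℝ} (hu : Tendsto u atTop (𝓝 0)) :
    (fun k => Real.log (1 - u k) + u k) =O[atTop] fun k => u k ^ 2 := by
  refine IsBigO.of_bound 2 ?_
  have hu_abs : Tendsto (fun k => |u k|) atTop (𝓝 0) := by simpa only [abs_zero] using hu.abs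
  filter_upwards [hu_abs.eventually_lt_const one_half_pos] with k hk
  have h_log := Real.abs_log_sub_add_sum_range_le (x := u k) (by linarith) 1
  simp only [Finset.sum_range_one, zero_add, pow_one, Nat.cast_zero, div_one,
    Nat.reduceAdd] at h_log
  rw [Real.norm_eq_abs, add_comm, norm_pow, Real.norm_eq_abs]
  refine h_log.trans ((div_le_iff₀ (by linarith)).mpr ?_)
  nlinarith [sq_nonneg |u k|]

section
variable (hpos : ∀ k, 0 < t k) (ht : Tendsto t atTop (𝓝 0))
include hpos ht

theorem rpow_isBigO_rpow_of_tendsto_zero {p q : ℝ} (hpq : p ≤ q) :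
    (fun k => t k ^ q) =O[atTop] fun k => t k ^ p := by
  refine IsBigO.of_bound 1 ?_
  filter_upwards [ht.eventually_le_const one_pos] with k hk
  rw [Real.norm_of_nonneg (Real.rpow_nonneg (hpos k).le _),
    Real.norm_of_nonneg (Real.rpow_nonneg (hpos k).le _), one_mul]
  exact Real.rpow_le_rpow_of_exponent_ge (hpos k) hk hpq

theorem sub_one_isBigO (hη0 : 0 < η)
    (hy : (fun k => y k - 1 + β * t k) =O[atTop] fun k => t k ^ (1 + η)) :
    (fun k => y k - 1) =O[atTop] t := by
  have h_rpow : (fun k => t k ^ (1 + η)) =O[atTop] t := by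
    simpa only [Real.rpow_one] using
      rpow_isBigO_rpow_of_tendsto_zero hpos ht (p := 1) (q := 1 + η) (by linarith)
  simpa using (hy.trans h_rpow).sub ((isBigO_refl t atTop).const_mul_left β)

theorem log_add_mul_isBigO (hη0 : 0 < η) (hη1 : η ≤ 1)
    (hy : (fun k => y k - 1 + β * t k) =O[atTop] fun k => t k ^ (1 + η)) :
    (fun k => Real.log (y k) + β * t k) =O[atTop] fun k => t k ^ (1 + η) := by
  have h_one_sub : (fun k => 1 - y k) =O[atTop] t := by
    simpa using (sub_one_isBigO hpos ht hη0 hy).neg_left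
  have h_sq : (fun k => (1 - y k) ^ 2) =O[atTop] fun k => t k ^ (1 + η) := by
    refine (h_one_sub.pow 2).trans ?_
    simpa only [Real.rpow_two] using
      rpow_isBigO_rpow_of_tendsto_zero hpos ht (p := 1 + η) (q := 2) (by linarith)
  have h_log := (log_one_sub_add_isBigO (h_one_sub.trans_tendsto ht)).trans h_sq
  refine (h_log.add hy).congr_left fun k => ?_
  rw [sub_sub_cancel]
  ring

end

section
variable (hpos : ∀ k, 0 < t k) (ht : Tendsto t atTop (𝓝 0)) (hγ : 0 < γ) (hη : 0 < η)
  (hrec : (fun k => t (k + 1) - t k + γ * t k ^ 2) =O[atTop] fun k => t k ^ (2 + η))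

include hpos hrec in
theorem ratio_isBigO :
    (fun k => t (k + 1) / t k - 1 + γ * t k) =O[atTop] fun k => t k ^ (1 + η) := by
  refine (hrec.mul (isBigO_refl (fun k => (t k)⁻¹) atTop)).congr (fun k => ?_) fun k => ?_
  · have := (hpos k).ne'
    field_simp
  · rw [← Real.rpow_neg_one, ← Real.rpow_add (hpos k)]
    ring_nf

include hpos ht hη hrec

theorem tendsto_inv_succ_sub_inv : Tendsto (fun k => (t (k + 1))⁻¹ - (t k)⁻¹) atTop (𝓝 γ) := by
  have h_ratio : Tendsto (fun k => t (k + 1) / t k) atTop (𝓝 1) := by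
    simpa using ((sub_one_isBigO hpos ht hη (ratio_isBigO hpos hrec)).trans_tendsto ht).add_const 1
  have h_error : Tendsto (fun k => (t (k + 1) / t k - 1 + γ * t k) * (t k)⁻¹) atTop (𝓝 0) := by
    have h_rpow : Tendsto (fun k => t k ^ η) atTop (𝓝 0) := by
      simpa only [Real.zero_rpow hη.ne'] using ht.rpow_const (p := η) (Or.inr hη.le)
    refine ((ratio_isBigO hpos hrec).mul (isBigO_refl (fun k => (t k)⁻¹) atTop)).trans_tendsto
      (h_rpow.congr fun k => ?_)
    rw [Real.rpow_add (hpos k), Real.rpow_one, mul_comm (t k), mul_assoc,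
      mul_inv_cancel₀ (hpos k).ne', mul_one]
  have h_quot := (h_error.const_sub γ).div h_ratio one_ne_zero
  rw [sub_zero, div_one] at h_quot
  refine h_quot.congr fun k => ?_
  have := (hpos k).ne'
  have := (hpos (k + 1)).ne'
  simp only [Pi.div_apply]
  field_simp
  ring

include hγ

theorem tendsto_natCast_mul : Tendsto (fun n : ℕ => (n : ℝ) * t n) atTop (𝓝 γ⁻¹) := by
  have h_cesaro := (tendsto_inv_succ_sub_inv hpos ht hη hrec).cesaro
  simp_rw [Finset.sum_range_sub (fun k => (t k)⁻¹)] at h_cesaro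
  have h_inv := (h_cesaro.add
    ((tendsto_inv_atTop_nhds_zero_nat (𝕜 := ℝ)).mul_const (t 0)⁻¹)).inv₀ (by simpa using hγ.ne')
  rw [zero_mul, add_zero] at h_inv
  refine h_inv.congr fun n => ?_
  rw [← mul_add, sub_add_cancel, mul_inv, inv_inv, inv_inv]

theorem summable_rpow {s : ℝ} (hs : 1 < s) : Summable fun k => t k ^ s := by
  refine summable_of_isBigO_nat (Real.summable_nat_rpow_inv.mpr hs) ?_
  have h_bdd : (fun n : ℕ => ((n : ℝ) * t n) ^ s) =O[atTop] fun _ => (1 : ℝ) :=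
    ((tendsto_natCast_mul hpos ht hγ hη hrec).rpow_const (Or.inl (inv_ne_zero hγ.ne'))).isBigO_one ℝ
  refine (h_bdd.mul (isBigO_refl (fun n : ℕ => ((n : ℝ) ^ s)⁻¹) atTop)).congr' ?_
    (Eventually.of_forall fun n => one_mul _)
  filter_upwards [eventually_gt_atTop 0] with n hn
  have : (0 : ℝ) < (n : ℝ) ^ s := Real.rpow_pos_of_pos (by exact_mod_cast hn) s
  rw [Real.mul_rpow n.cast_nonneg (hpos n).le]
  field_simp

end

theorem prod_eq_exp_mul_div_rpow (hpos : ∀ k, 0 < t k) (hy : ∀ k, 0 < y k) (α : ℝ) (n : ℕ) :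
    ∏ k ∈ Finset.range n, y k =
      Real.exp (∑ k ∈ Finset.range n, (Real.log (y k) - α * Real.log (t (k + 1) / t k))) *
        (t n / t 0) ^ α := by
  have h_log : ∀ k, Real.log (t (k + 1) / t k) = Real.log (t (k + 1)) - Real.log (t k) :=
    fun k => Real.log_div (hpos _).ne' (hpos _).ne'
  rw [Finset.sum_sub_distrib, ← Finset.mul_sum, Finset.sum_congr rfl fun k _ => h_log k,
    Finset.sum_range_sub fun k => Real.log (t k), ← Real.log_div (hpos _).ne' (hpos _).ne',
    Real.rpow_def_of_pos (div_pos (hpos _) (hpos _)), ← Real.exp_add, mul_comm α,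
    sub_add_cancel, Real.exp_sum]
  exact Finset.prod_congr rfl fun k _ => (Real.exp_log (hy k)).symm

theorem exists_tendsto_rpow_mul_prod (hpos : ∀ k, 0 < t k) (ht : Tendsto t atTop (𝓝 0))
    (hγ : 0 < γ) (hη0 : 0 < η) (hη1 : η ≤ 1)
    (hrec : (fun k => t (k + 1) - t k + γ * t k ^ 2) =O[atTop] fun k => t k ^ (2 + η))
    (hy : ∀ k, 0 < y k) (hyt : (fun k => y k - 1 + β * t k) =O[atTop] fun k => t k ^ (1 + η)) :
    ∃ L : ℝ, 0 < L ∧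
      Tendsto (fun n : ℕ => (n : ℝ) ^ (β / γ) * ∏ k ∈ Finset.range n, y k) atTop (𝓝 L) := by
  -- The exponent `β / γ` is the one for which the terms linear in `t k` cancel.
  have h_summable : Summable fun k => Real.log (y k) - β / γ * Real.log (t (k + 1) / t k) := by
    refine summable_of_isBigO_nat
      (summable_rpow hpos ht hγ hη0 hrec (by linarith : 1 < 1 + η)) ?_
    refine ((log_add_mul_isBigO hpos ht hη0 hη1 hyt).sub
      ((log_add_mul_isBigO hpos ht hη0 hη1 (ratio_isBigO hpos hrec)).const_mul_left
        (β / γ))).congr_left fun k => ?_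
    field_simp
    ring
  have h_rpow := (tendsto_natCast_mul hpos ht hγ hη0 hrec).rpow_const (p := β / γ)
    (Or.inl (inv_ne_zero hγ.ne'))
  have h_exp := (Real.continuous_exp.tendsto _).comp h_summable.hasSum.tendsto_sum_nat
  have h_t0 : 0 < t 0 ^ (β / γ) := Real.rpow_pos_of_pos (hpos 0) _
  refine ⟨_, by positivity, ((h_exp.mul h_rpow).div_const (t 0 ^ (β / γ))).congr fun n => ?_⟩
  rw [prod_eq_exp_mul_div_rpow hpos hy (β / γ), Real.mul_rpow n.cast_nonneg (hpos n).le,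
    Real.div_rpow (hpos n).le (hpos 0).le, Function.comp_apply]
  ring

end Recursion

section Tails

theorem exp_le_one_add_add_sq_mul_exp {u v : ℝ} (huv : u ≤ v) (hv : 0 ≤ v) :
    Real.exp u ≤ 1 + u + u ^ 2 * Real.exp v := by
  have hexp : Real.exp u * (1 - u) ≤ 1 := by
    have h := mul_le_mul_of_nonneg_left (Real.one_sub_le_exp_neg u) (Real.exp_pos u).le
    rwa [← Real.exp_add, add_neg_cancel, Real.exp_zero] at h
  rcases le_total 0 u with hu | hu
  · nlinarith [mul_le_mul_of_nonneg_left hexp hu,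
      mul_le_mul_of_nonneg_left (Real.exp_le_exp.mpr huv) (sq_nonneg u)]
  · nlinarith [mul_le_mul_of_nonneg_left (Real.one_le_exp hv) (sq_nonneg u), Real.exp_pos u,
      pow_nonneg (neg_nonneg.mpr hu) 3]

theorem sq_log_le_sixteen_mul_rpow {x : ℝ} (hx : 1 ≤ x) :
    Real.log x ^ 2 ≤ 16 * x ^ (1 / 2 : ℝ) := by
  have hx0 : 0 ≤ x := zero_le_one.trans hx
  calc Real.log x ^ 2 ≤ (x ^ (1 / 4 : ℝ) / (1 / 4)) ^ 2 :=
        pow_le_pow_left₀ (Real.log_nonneg hx) (Real.log_le_rpow_div hx0 (by norm_num)) 2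
    _ = 16 * x ^ (1 / 2 : ℝ) := by
        rw [div_pow, ← Real.rpow_natCast, ← Real.rpow_mul hx0]
        norm_num
        ring

variable {Ω : Type*} [MeasurableSpace Ω] {P : Measure Ω}

theorem measureReal_lt_le_integral_rpow_mul [IsFiniteMeasure P] {V : Ω → ℝ} {p y : ℝ}
    (hp : 0 ≤ p) (hy : 0 < y) (hV : Integrable (fun ω => |V ω| ^ p) P) :
    P.real {ω | y < V ω} ≤ (∫ ω, |V ω| ^ p ∂P) * y ^ (-p) := by
  have hmarkov := mul_meas_ge_le_integral_of_nonneg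
    (ae_of_all P fun ω => Real.rpow_nonneg (abs_nonneg (V ω)) p) hV (y ^ p)
  have hsub : {ω | y < V ω} ⊆ {ω | y ^ p ≤ |V ω| ^ p} := fun ω hω =>
    Real.rpow_le_rpow hy.le ((Set.mem_ofPred_eq ▸ hω).le.trans (le_abs_self _)) hp
  rw [Real.rpow_neg hy.le, ← div_eq_mul_inv, le_div_iff₀ (Real.rpow_pos_of_pos hy p), mul_comm]
  exact (mul_le_mul_of_nonneg_left (measureReal_mono hsub)
    (Real.rpow_pos_of_pos hy p).le).trans hmarkov

theorem integrable_exp_mul_of_le [IsFiniteMeasure P] {V : Ω → ℝ} (hV : Measurable V) {s M : ℝ}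
    (hM : ∀ ω, s * V ω ≤ M) : Integrable (fun ω => Real.exp (s * V ω)) P :=
  Integrable.of_bound (hV.const_mul s).exp.aestronglyMeasurable (Real.exp M)
    (ae_of_all _ fun ω => by
      rw [Real.norm_of_nonneg (Real.exp_pos _).le]
      exact Real.exp_le_exp.mpr (hM ω))

variable {U : ℕ → Ω → ℝ}

theorem measureReal_lt_sum_le_truncated [IsFiniteMeasure P] (k : ℕ) (M v : ℝ) :
    P.real {ω | v < ∑ i ∈ Finset.range k, U i ω} ≤
      ∑ i ∈ Finset.range k, P.real {ω | M < U i ω} +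
        P.real {ω | v ≤ ∑ i ∈ Finset.range k, min (U i ω) M} := by
  refine (measureReal_mono (fun ω hω => ?_)).trans ((measureReal_union_le _ _).trans
    (add_le_add_left (measureReal_biUnion_finset_le (Finset.range k) fun i => {ω | M < U i ω}) _))
  by_cases hjump : ∃ i ∈ Finset.range k, M < U i ω
  · obtain ⟨i, hi, hlt⟩ := hjump
    exact Or.inl (Set.mem_biUnion hi hlt)
  · push Not at hjump
    refine Or.inr ?_
    rw [Set.mem_ofPred_eq, Finset.sum_congr rfl fun i hi => min_eq_left (hjump i hi)]
    exact le_of_lt hω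

theorem sum_measureReal_lt_le [IsFiniteMeasure P] (hid : ∀ i, IdentDistrib (U i) (U 0) P P)
    {r θ : ℝ} (hr : 0 < r) (hθ : 0 < θ) (hU : Integrable (fun ω => |U 0 ω| ^ (r + 1)) P)
    {k : ℕ} (hk : 1 ≤ k) :
    ∑ i ∈ Finset.range k, P.real {ω | θ * k < U i ω} ≤
      (∫ ω, |U 0 ω| ^ (r + 1) ∂P) * θ ^ (-(r + 1)) * (k : ℝ) ^ (-r) := by
  have hk0 : (0 : ℝ) < k := by exact_mod_cast hk
  have hterm : ∀ i, P.real {ω | θ * k < U i ω} ≤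
      (∫ ω, |U 0 ω| ^ (r + 1) ∂P) * (θ * k) ^ (-(r + 1)) := fun i =>
    (congrArg ENNReal.toReal ((hid i).measure_mem_eq measurableSet_Ioi)).trans_le
      (measureReal_lt_le_integral_rpow_mul (by linarith) (by positivity) hU)
  refine (Finset.sum_le_sum fun i _ => hterm i).trans_eq ?_
  have hpow : (k : ℝ) * (k : ℝ) ^ (-(r + 1)) = (k : ℝ) ^ (-r) := by
    rw [← Real.rpow_one_add' hk0.le (by linarith)]; congr 1; ring
  rw [Finset.sum_const, Finset.card_range, nsmul_eq_mul, Real.mul_rpow hθ.le hk0.le, ← hpow]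
  ring

variable [IsProbabilityMeasure P]

theorem mgf_le_exp_of_mul_le {W : Ω → ℝ} {s M : ℝ} (hM0 : 0 ≤ M) (hM : ∀ ω, s * W ω ≤ M)
    (hW1 : Integrable W P) (hW2 : Integrable (fun ω => W ω ^ 2) P) :
    mgf W P s ≤ Real.exp (s * ∫ ω, W ω ∂P + s ^ 2 * Real.exp M * ∫ ω, W ω ^ 2 ∂P) := by
  have hlin : Integrable (fun ω => 1 + s * W ω) P := (integrable_const 1).add (hW1.const_mul s)
  have hsq := hW2.const_mul (s ^ 2 * Real.exp M)
  calc mgf W P s ≤ ∫ ω, (1 + s * W ω + s ^ 2 * Real.exp M * W ω ^ 2) ∂P :=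
        integral_mono_of_nonneg (ae_of_all _ fun ω => (Real.exp_pos _).le) (hlin.add hsq)
          (ae_of_all _ fun ω => (exp_le_one_add_add_sq_mul_exp (hM ω) hM0).trans_eq (by ring))
    _ = (s * ∫ ω, W ω ∂P + s ^ 2 * Real.exp M * ∫ ω, W ω ^ 2 ∂P) + 1 := by
        rw [integral_add hlin hsq, integral_add (integrable_const 1) (hW1.const_mul s),
          integral_const_mul, integral_const_mul]
        simp only [integral_const, probReal_univ, smul_eq_mul, mul_one]
        ring
    _ ≤ _ := Real.add_one_le_exp _

theorem measureReal_le_sum_le_exp {W : ℕ → Ω → ℝ} (hm : ∀ i, Measurable (W i))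
    (hi : iIndepFun W P) (hid : ∀ i, IdentDistrib (W i) (W 0) P P) {s M κ : ℝ} (hs : 0 ≤ s)
    (hM : ∀ i ω, s * W i ω ≤ M) (hκ : mgf (W 0) P s ≤ Real.exp κ) (k : ℕ) (v : ℝ) :
    P.real {ω | v ≤ ∑ i ∈ Finset.range k, W i ω} ≤ Real.exp (-s * v + k * κ) := by
  have hmgf : mgf (∑ i ∈ Finset.range k, W i) P s ≤ Real.exp (k * κ) := by
    rw [hi.mgf_sum hm, Finset.prod_congr rfl fun i _ =>
      mgf_congr_of_identDistrib (W i) (W 0) (hid i) s, Finset.prod_const, Finset.card_range,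
      Real.exp_nat_mul]
    exact pow_le_pow_left₀ mgf_nonneg hκ k
  simp only [← Finset.sum_apply]
  rw [Real.exp_add]
  exact (measure_ge_le_exp_mul_mgf v hs (hi.integrable_exp_mul_sum hm fun i _ =>
    integrable_exp_mul_of_le (hm i) (hM i))).trans
    (mul_le_mul_of_nonneg_left hmgf (Real.exp_pos _).le)

/-- The exponent `s = (r / ε) log k / k` balances the two terms: `s ε k = r log k`, while the
second-order term `k s² √k` stays bounded because `log² k = O(√k)`. -/
theorem measureReal_mean_add_mul_le_sum_le {W : ℕ → Ω → ℝ} (hm : ∀ i, Measurable (W i))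
    (hi : iIndepFun W P) (hid : ∀ i, IdentDistrib (W i) (W 0) P P)
    (hW1 : Integrable (W 0) P) (hW2 : Integrable (fun ω => W 0 ω ^ 2) P) {r ε : ℝ} (hr : 0 < r)
    (hε : 0 < ε) {k : ℕ} (hk : 1 ≤ k) (hle : ∀ i ω, W i ω ≤ ε / (2 * r) * k) :
    P.real {ω | (∫ ω, W 0 ω ∂P + ε) * k ≤ ∑ i ∈ Finset.range k, W i ω} ≤
      Real.exp (16 * (r / ε) ^ 2 * ∫ ω, W 0 ω ^ 2 ∂P) * (k : ℝ) ^ (-r) := by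
  have hk1 : (1 : ℝ) ≤ k := by exact_mod_cast hk
  have hk0 : (0 : ℝ) < k := zero_lt_one.trans_le hk1
  set s := r / ε * Real.log k / k with hs
  have hs0 : 0 ≤ s :=
    div_nonneg (mul_nonneg (div_pos hr hε).le (Real.log_nonneg hk1)) hk0.le
  have hM : ∀ i ω, s * W i ω ≤ Real.log k * (1 / 2) := fun i ω =>
    (mul_le_mul_of_nonneg_left (hle i ω) hs0).trans_eq (by rw [hs]; field_simp)
  have hmgf :=
    mgf_le_exp_of_mul_le (mul_nonneg (Real.log_nonneg hk1) one_half_pos.le) (hM 0) hW1 hW2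
  rw [← Real.rpow_def_of_pos hk0] at hmgf
  refine (measureReal_le_sum_le_exp hm hi hid hs0 hM hmgf k _).trans ?_
  rw [Real.rpow_def_of_pos hk0 (-r), ← Real.exp_add]
  refine Real.exp_le_exp.mpr ?_
  have hfirst : s * (ε * k) = r * Real.log k := by rw [hs]; field_simp
  have hsecond : (k : ℝ) * (s ^ 2 * (k : ℝ) ^ (1 / 2 : ℝ)) ≤ 16 * (r / ε) ^ 2 := by
    have hsqrt : (k : ℝ) ^ (1 / 2 : ℝ) * (k : ℝ) ^ (1 / 2 : ℝ) = k := by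
      rw [← Real.rpow_add hk0]; norm_num
    calc (k : ℝ) * (s ^ 2 * (k : ℝ) ^ (1 / 2 : ℝ))
        = (r / ε) ^ 2 * (Real.log k ^ 2 * (k : ℝ) ^ (1 / 2 : ℝ)) / k := by rw [hs]; field_simp
      _ ≤ (r / ε) ^ 2 * (16 * (k : ℝ) ^ (1 / 2 : ℝ) * (k : ℝ) ^ (1 / 2 : ℝ)) / k := by
          gcongr
          exact sq_log_le_sixteen_mul_rpow hk1
      _ = 16 * (r / ε) ^ 2 := by rw [mul_assoc, hsqrt]; field_simp
  linarith [mul_le_mul_of_nonneg_right hsecond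
    (integral_nonneg fun ω => sq_nonneg (W 0 ω) : 0 ≤ ∫ ω, W 0 ω ^ 2 ∂P)]

theorem abs_min_le_abs_of_nonneg {u M : ℝ} (hM : 0 ≤ M) : |min u M| ≤ |u| :=
  abs_le.mpr ⟨le_min (neg_abs_le u) ((neg_nonpos.mpr (abs_nonneg u)).trans hM),
    (min_le_left u M).trans (le_abs_self u)⟩

theorem exists_measureReal_lt_sum_le (hm : ∀ i, Measurable (U i)) (hi : iIndepFun U P)
    (hid : ∀ i, IdentDistrib (U i) (U 0) P P) {r ε : ℝ} (hr : 0 < r) (hε : 0 < ε)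
    (hU2 : MemLp (U 0) 2 P) (hUr : Integrable (fun ω => |U 0 ω| ^ (r + 1)) P) :
    ∃ C : ℝ, 0 ≤ C ∧ ∀ k : ℕ, 1 ≤ k →
      P.real {ω | (∫ ω, U 0 ω ∂P + ε) * k < ∑ i ∈ Finset.range k, U i ω} ≤
        C * (k : ℝ) ^ (-r) := by
  have hU1 : Integrable (U 0) P := hU2.integrable one_le_two
  have hθ : 0 < ε / (2 * r) := by positivity
  refine ⟨(∫ ω, |U 0 ω| ^ (r + 1) ∂P) * (ε / (2 * r)) ^ (-(r + 1)) +
    Real.exp (16 * (r / ε) ^ 2 * ∫ ω, U 0 ω ^ 2 ∂P),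
    add_nonneg (mul_nonneg (integral_nonneg fun ω => by positivity) (by positivity))
      (Real.exp_pos _).le, fun k hk => ?_⟩
  have hk0 : (0 : ℝ) < k := by exact_mod_cast hk
  set M := ε / (2 * r) * k
  have hM0 : 0 ≤ M := by positivity
  have hmin : Measurable fun x : ℝ => min x M := measurable_id.min measurable_const
  have hminU : ∀ i, Measurable fun ω => min (U i ω) M := fun i => hmin.comp (hm i)
  have hW2 : MemLp (fun ω => min (U 0 ω) M) 2 P :=
    hU2.mono (hminU 0).aestronglyMeasurable (ae_of_all _ fun ω => abs_min_le_abs_of_nonneg hM0)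
  have hW1 := hW2.integrable one_le_two
  have hchernoff := measureReal_mean_add_mul_le_sum_le hminU (hi.comp _ fun _ => hmin)
    (fun i => (hid i).comp hmin) hW1 hW2.integrable_sq hr hε hk fun i ω => min_le_right _ _
  have hmean : ∫ ω, min (U 0 ω) M ∂P ≤ ∫ ω, U 0 ω ∂P :=
    integral_mono hW1 hU1 fun ω => min_le_left _ _
  have hsq : ∫ ω, min (U 0 ω) M ^ 2 ∂P ≤ ∫ ω, U 0 ω ^ 2 ∂P :=
    integral_mono hW2.integrable_sq hU2.integrable_sq fun ω =>
      sq_le_sq.mpr (abs_min_le_abs_of_nonneg hM0)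
  refine (measureReal_lt_sum_le_truncated k M _).trans ((add_le_add
    (sum_measureReal_lt_le hid hr hθ hUr hk) ((measureReal_mono fun ω hω => ?_).trans
      (hchernoff.trans (by gcongr)))).trans_eq (add_mul _ _ _).symm)
  exact (mul_le_mul_of_nonneg_right (add_le_add_left hmean ε) hk0.le).trans hω

theorem exists_measureReal_abs_sum_sub_le (hm : ∀ i, Measurable (U i)) (hi : iIndepFun U P)
    (hid : ∀ i, IdentDistrib (U i) (U 0) P P) {r ε : ℝ} (hr : 0 < r) (hε : 0 < ε)
    (hU2 : MemLp (U 0) 2 P) (hUr : Integrable (fun ω => |U 0 ω| ^ (r + 1)) P) :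
    ∃ C : ℝ, 0 ≤ C ∧ ∀ k : ℕ, 1 ≤ k →
      P.real {ω | ε * k < |∑ i ∈ Finset.range k, U i ω - k * ∫ ω, U 0 ω ∂P|} ≤
        C * (k : ℝ) ^ (-r) := by
  obtain ⟨C, hC, hupper⟩ := exists_measureReal_lt_sum_le hm hi hid hr hε hU2 hUr
  obtain ⟨D, hD, hlower⟩ := exists_measureReal_lt_sum_le (fun i => (hm i).neg)
    (hi.comp (fun _ x => -x) fun _ => measurable_neg) (fun i => (hid i).comp measurable_neg) hr hε
    hU2.neg (by simpa only [Pi.neg_apply, abs_neg] using hUr)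
  refine ⟨C + D, by positivity, fun k hk => ?_⟩
  rw [add_mul]
  refine (measureReal_mono fun ω hω => ?_).trans
    ((measureReal_union_le _ _).trans (add_le_add (hupper k hk) (hlower k hk)))
  rw [Set.mem_ofPred_eq, lt_abs] at hω
  simp only [Set.mem_union, Set.mem_ofPred_eq, Pi.neg_apply, integral_neg,
    Finset.sum_neg_distrib]
  rcases hω with hω | hω
  · exact Or.inl (by linarith)
  · exact Or.inr (by linarith)

end Tails

theorem exists_pos_of_hasSum_pos {ι : Type*} {f : ι → ℝ} {s : ℝ} (hf : HasSum f s) (hs : 0 < s) :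
    ∃ i, 0 < f i := by
  by_contra! hcon
  exact (hasSum_le hcon hf hasSum_zero).not_gt hs

section ProbabilityGenFun

variable {a : ℕ → ℝ} (h0 : ∀ j, 0 ≤ a j) (ha : HasSum a 1)
include h0 ha

theorem coeff_zero_le_genFun {x : ℝ} (hx : x ∈ Set.Icc 0 1) : a 0 ≤ genFun a x := by
  simpa only [genFun, pow_zero, mul_one] using
    (summable_mul_pow_of_nonneg h0 ha.summable hx.1 hx.2).le_tsum 0
      fun j _ => mul_nonneg (h0 j) (pow_nonneg hx.1 j)

theorem mapsTo_genFun_Icc : Set.MapsTo (genFun a) (Set.Icc 0 1) (Set.Icc 0 1) := by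
  intro x hx
  refine ⟨(h0 0).trans (coeff_zero_le_genFun h0 ha hx), ?_⟩
  rw [← ha.tsum_eq]
  exact (summable_mul_pow_of_nonneg h0 ha.summable hx.1 hx.2).tsum_le_tsum
    (fun j => mul_le_of_le_one_right (h0 j) (pow_le_one₀ hx.1 hx.2)) ha.summable

theorem mapsTo_genFun_Ico {i : ℕ} (hi : i ≠ 0) (hai : 0 < a i) :
    Set.MapsTo (genFun a) (Set.Ico 0 1) (Set.Ico 0 1) := by
  intro x hx
  refine ⟨(mapsTo_genFun_Icc h0 ha ⟨hx.1, hx.2.le⟩).1, ?_⟩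
  rw [← ha.tsum_eq]
  exact Summable.tsum_lt_tsum (i := i)
    (fun j => mul_le_of_le_one_right (h0 j) (pow_le_one₀ hx.1 hx.2.le))
    (mul_lt_of_lt_one_right hai (pow_lt_one₀ hx.1 hx.2 hi))
    (summable_mul_pow_of_nonneg h0 ha.summable hx.1 hx.2.le) ha.summable

end ProbabilityGenFun

section Critical

theorem exists_two_le_pos {a : ℕ → ℝ} {γ : ℝ} (h0 : ∀ j, 0 ≤ a j) (hγ0 : 0 < γ)
    (hγ : HasSum (fun j => a j * (j * (j - 1) / 2)) γ) : ∃ j, 2 ≤ j ∧ 0 < a j := by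
  obtain ⟨j, hj⟩ := exists_pos_of_hasSum_pos hγ hγ0
  refine ⟨j, ?_, (h0 j).lt_of_ne' (left_ne_zero_of_mul hj.ne')⟩
  by_contra! hj2
  interval_cases j <;> simp at hj

variable {a b : ℕ → ℝ} {β γ : ℝ} (h0 : ∀ j, 0 ≤ a j) (ha : HasSum a 1)
  (hm : HasSum (fun j => a j * (j : ℝ)) 1) (hγ0 : 0 < γ)
  (hγ : HasSum (fun j => a j * (j * (j - 1) / 2)) γ)

include h0 ha hm in
theorem one_sub_genFun_one_sub_le {i : ℕ} (hi : 2 ≤ i) {t : ℝ} (ht : t ∈ Set.Icc 0 1) :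
    1 - genFun a (1 - t) ≤ t - a i * t ^ 2 := by
  have hterm := le_hasSum (hasSum_genFun_taylor_one h0 ha hm ht.1 ht.2) i fun j _ =>
    mul_nonneg (h0 j) (one_sub_pow_taylor_one_nonneg ht.2 j)
  linarith [mul_le_mul_of_nonneg_left (sq_le_one_sub_pow_taylor_one ht.2 hi) (h0 i)]

include h0 ha hγ0 hγ in
theorem iterate_genFun_zero_mem_Ico (k : ℕ) : (genFun a)^[k] 0 ∈ Set.Ico (0 : ℝ) 1 := by
  obtain ⟨i, hi, hai⟩ := exists_two_le_pos h0 hγ0 hγ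
  exact (mapsTo_genFun_Ico h0 ha (by omega) hai).iterate k ⟨le_rfl, zero_lt_one⟩

include h0 ha hm hγ0 hγ

theorem exists_one_sub_iterate_genFun_le :
    ∃ c : ℝ, 0 < c ∧ ∀ k : ℕ, 1 - (genFun a)^[k] 0 ≤ (1 + c * k)⁻¹ := by
  obtain ⟨i, hi, hai⟩ := exists_two_le_pos h0 hγ0 hγ
  have hmem := iterate_genFun_zero_mem_Ico h0 ha hγ0 hγ
  have hpos : ∀ k, 0 < 1 - (genFun a)^[k] 0 := fun k => sub_pos.mpr (hmem k).2
  refine ⟨a i, hai, fun k => ?_⟩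
  have hinv := inv_add_mul_le_inv_of_le_sub_sq hpos hai (fun k => by
    simpa only [sub_sub_cancel, ← Function.iterate_succ_apply'] using
      one_sub_genFun_one_sub_le h0 ha hm hi ⟨(hpos k).le, sub_le_self _ (hmem k).1⟩) k
  rw [Function.iterate_zero_apply, sub_zero, inv_one] at hinv
  exact le_inv_of_le_inv₀ (by positivity) hinv

theorem tendsto_one_sub_iterate_genFun :
    Tendsto (fun k => 1 - (genFun a)^[k] 0) atTop (𝓝 0) := by
  obtain ⟨c, hc, hle⟩ := exists_one_sub_iterate_genFun_le h0 ha hm hγ0 hγ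
  refine squeeze_zero
    (fun k => (sub_pos.mpr (iterate_genFun_zero_mem_Ico h0 ha hγ0 hγ k).2).le) hle ?_
  exact tendsto_inv_atTop_zero.comp
    (tendsto_atTop_add_const_left _ _ (tendsto_natCast_atTop_atTop.const_mul_atTop hc))

theorem exists_tendsto_rpow_mul_prod_genFun {η : ℝ} (hη : η ∈ Set.Ioc 0 1)
    (haη : Summable fun j => a j * (j : ℝ) ^ (2 + η))
    (hb0 : ∀ j, 0 ≤ b j) (hb : HasSum b 1) (hb00 : 0 < b 0)
    (hβ : HasSum (fun j => b j * (j : ℝ)) β) (hbη : Summable fun j => b j * (j : ℝ) ^ (1 + η)) :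
    ∃ L : ℝ, 0 < L ∧ Tendsto (fun n : ℕ => (n : ℝ) ^ (β / γ) *
      ∏ k ∈ Finset.range n, genFun b ((genFun a)^[k] 0)) atTop (𝓝 L) := by
  have hmem := iterate_genFun_zero_mem_Ico h0 ha hγ0 hγ
  have hpos : ∀ k, 0 < 1 - (genFun a)^[k] 0 := fun k => sub_pos.mpr (hmem k).2
  have hle : ∀ k, 1 - (genFun a)^[k] 0 ≤ 1 := fun k => sub_le_self _ (hmem k).1
  have hη' : η ∈ Set.Icc 0 1 := ⟨hη.1.le, hη.2⟩
  refine exists_tendsto_rpow_mul_prod hpos (tendsto_one_sub_iterate_genFun h0 ha hm hγ0 hγ) hγ0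
    hη.1 hη.2 (IsBigO.of_bound (∑' j, a j * (j : ℝ) ^ (2 + η)) (Eventually.of_forall fun k => ?_))
    (fun k => hb00.trans_le (coeff_zero_le_genFun hb0 hb ⟨(hmem k).1, (hmem k).2.le⟩))
    (IsBigO.of_bound (∑' j, b j * (j : ℝ) ^ (1 + η)) (Eventually.of_forall fun k => ?_))
  · have htaylor := abs_genFun_taylor_two_le h0 ha hm (hpos k).le (hle k) hγ hη' haη.hasSum
    rw [sub_sub_cancel] at htaylor
    rw [Real.norm_eq_abs, Real.norm_of_nonneg (Real.rpow_nonneg (hpos k).le _), ← abs_neg,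
      Function.iterate_succ_apply']
    refine (congrArg abs ?_).trans_le htaylor
    ring
  · have htaylor := abs_genFun_taylor_one_le hb0 hb hβ (hpos k).le (hle k) hη' hbη.hasSum
    rw [sub_sub_cancel] at htaylor
    rwa [Real.norm_eq_abs, Real.norm_of_nonneg (Real.rpow_nonneg (hpos k).le _)]

end Critical

section PointMass

variable {Ω : Type*} [MeasurableSpace Ω] {P : Measure Ω} {V : Ω → ℕ}

theorem pointMass_nonneg (j : ℕ) : 0 ≤ pointMass P V j := measureReal_nonneg

theorem hasSum_pointMass_mul (hV : Measurable V) {f : ℕ → ℝ}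
    (hf : Integrable (fun ω => f (V ω)) P) :
    HasSum (fun j => pointMass P V j * f j) (∫ ω, f (V ω) ∂P) := by
  have h_iUnion := hasSum_integral_iUnion (s := fun j => V ⁻¹' {j})
    (fun j => hV (measurableSet_singleton j))
    (fun i j hij => Disjoint.preimage V (Set.disjoint_singleton.mpr hij)) hf.integrableOn
  rw [← Set.preimage_iUnion, Set.iUnion_of_singleton, Set.preimage_univ, setIntegral_univ]
    at h_iUnion
  refine h_iUnion.congr_fun fun j => ?_
  rw [setIntegral_congr_fun (g := fun _ => f j) (hV (measurableSet_singleton j))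
    fun ω hω => congrArg f hω, setIntegral_const, smul_eq_mul]
  rfl

theorem hasSum_pointMass [IsProbabilityMeasure P] (hV : Measurable V) :
    HasSum (pointMass P V) 1 := by
  simpa using hasSum_pointMass_mul (P := P) hV (f := fun _ => 1) (integrable_const _)

theorem integrable_natCast_rpow_of_le (hV : Measurable V) {s p : ℝ}
    (hs : 0 < s) (hsp : s ≤ p) (hint : Integrable (fun ω => (V ω : ℝ) ^ p) P) :
    Integrable (fun ω => (V ω : ℝ) ^ s) P := by
  refine hint.mono ((Measurable.of_discrete (f := fun j : ℕ => (j : ℝ) ^ s)).comp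
    hV).aestronglyMeasurable (ae_of_all _ fun ω => ?_)
  rw [Real.norm_of_nonneg (by positivity), Real.norm_of_nonneg (by positivity)]
  rcases Nat.eq_zero_or_pos (V ω) with h_zero | h_pos
  · rw [h_zero, Nat.cast_zero, Real.zero_rpow hs.ne', Real.zero_rpow (hs.trans_le hsp).ne']
  · exact Real.rpow_le_rpow_of_exponent_le (Nat.one_le_cast.mpr h_pos) hsp

theorem ennEval_lawSeries_le_one [IsProbabilityMeasure P] (hV : Measurable V) {x : ℝ≥0∞}
    (hx : x ≤ 1) : ennEval (lawSeries P V) x ≤ 1 := by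
  calc ennEval (lawSeries P V) x ≤ ∑' j, P (V ⁻¹' {j} ∩ Set.univ) :=
        ENNReal.tsum_le_tsum fun j => by
          rw [coeff_lawSeries, Set.inter_univ]
          exact mul_le_of_le_one_right' (pow_le_one' hx j)
    _ = 1 := by rw [← measure_eq_tsum_preimage_singleton_inter hV, measure_univ]

theorem ennEval_lawSeries [IsProbabilityMeasure P] (hV : Measurable V) {x : ℝ}
    (hx : x ∈ Set.Icc 0 1) :
    ennEval (lawSeries P V) (ENNReal.ofReal x) = ENNReal.ofReal (genFun (pointMass P V) x) := by
  rw [genFun, ENNReal.ofReal_tsum_of_nonneg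
    (fun j => mul_nonneg (pointMass_nonneg j) (pow_nonneg hx.1 j))
    (summable_mul_pow_of_nonneg pointMass_nonneg (hasSum_pointMass hV).summable hx.1 hx.2)]
  refine tsum_congr fun j => ?_
  rw [coeff_lawSeries, ENNReal.ofReal_mul (pointMass_nonneg j), ENNReal.ofReal_pow hx.1,
    pointMass, ofReal_measureReal]
  rfl

theorem iterate_ennEval_lawSeries [IsProbabilityMeasure P] (hV : Measurable V) (k : ℕ) :
    (ennEval (lawSeries P V))^[k] 0 = ENNReal.ofReal ((genFun (pointMass P V))^[k] 0) := by
  have h_maps := mapsTo_genFun_Icc pointMass_nonneg (hasSum_pointMass (P := P) hV)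
  induction k with
  | zero => simp only [Function.iterate_zero_apply, ENNReal.ofReal_zero]
  | succ k ih =>
    rw [Function.iterate_succ_apply', ih,
      ennEval_lawSeries hV (h_maps.iterate k (by simp)), Function.iterate_succ_apply']

end PointMass

section PowerWeights

theorem exp_neg_inv_le_one_sub_pow {c s : ℝ} (hc : 0 < c) {m : ℕ} (hm : 0 < m)
    (hs : s ≤ (1 + c * m)⁻¹) : Real.exp (-c⁻¹) ≤ (1 - s) ^ m := by
  have h_base : Real.exp (-(c * m)⁻¹) ≤ 1 - s := by
    calc Real.exp (-(c * m)⁻¹) ≤ (1 + (c * m)⁻¹)⁻¹ := by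
          rw [Real.exp_neg, add_comm]
          exact inv_anti₀ (by positivity) (Real.add_one_le_exp _)
      _ = 1 - (1 + c * m)⁻¹ := by field_simp; ring
      _ ≤ 1 - s := by linarith
  calc Real.exp (-c⁻¹) = Real.exp (-(c * m)⁻¹) ^ m := by
        rw [← Real.exp_nat_mul]; congr 1; field_simp
    _ ≤ (1 - s) ^ m := pow_le_pow_left₀ (Real.exp_pos _).le h_base m

variable {c r : ℝ} {x : ℕ → ℝ}

theorem rpow_neg_le_rpow_neg_mul_pow (hc : 0 < c) (hr : 0 ≤ r) {k m : ℕ} (hk : 0 < k)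
    (hkm : k ≤ m) (hm : m ≤ 2 * k) {x : ℝ} (hx0 : 0 ≤ x) (hx1 : x ≤ 1)
    (hxc : 1 - x ≤ (1 + c * m)⁻¹) :
    (k : ℝ) ^ (-r) ≤ Real.exp c⁻¹ * 2 ^ r * (m : ℝ) ^ (-r) * x ^ k := by
  have hk0 : (0 : ℝ) < k := Nat.cast_pos.mpr hk
  have hm0 : (0 : ℝ) < m := Nat.cast_pos.mpr (hk.trans_le hkm)
  have h_pow : 1 ≤ Real.exp c⁻¹ * x ^ k := by
    calc 1 = Real.exp c⁻¹ * Real.exp (-c⁻¹) := by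
          rw [← Real.exp_add, add_neg_cancel, Real.exp_zero]
      _ ≤ Real.exp c⁻¹ * x ^ k := by
          refine mul_le_mul_of_nonneg_left ?_ (Real.exp_pos _).le
          rw [← sub_sub_cancel 1 x] at hx0 hx1 ⊢
          exact (exp_neg_inv_le_one_sub_pow hc (hk.trans_le hkm) hxc).trans
            (pow_le_pow_of_le_one hx0 hx1 hkm)
  have h_rpow : (k : ℝ) ^ (-r) ≤ 2 ^ r * (m : ℝ) ^ (-r) := by
    calc (k : ℝ) ^ (-r) = 2 ^ r * (2 * (k : ℝ)) ^ (-r) := by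
          rw [Real.mul_rpow zero_le_two hk0.le, ← mul_assoc, ← Real.rpow_add two_pos,
            add_neg_cancel, Real.rpow_zero, one_mul]
      _ ≤ 2 ^ r * (m : ℝ) ^ (-r) := mul_le_mul_of_nonneg_left
        (Real.rpow_le_rpow_of_nonpos hm0 (by exact_mod_cast hm) (by linarith)) (by positivity)
  linarith [mul_le_mul h_pow h_rpow (by positivity) (by positivity)]

theorem ofReal_rpow_neg_le_tsum_mul_pow (hc : 0 < c) (hr : 0 < r) (hx0 : ∀ m, 0 ≤ x m)
    (hx1 : ∀ m, x m ≤ 1) (hxc : ∀ m : ℕ, 1 - x m ≤ (1 + c * m)⁻¹) (k : ℕ) :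
    ENNReal.ofReal ((k : ℝ) ^ (-r)) ≤ ∑' m : ℕ,
      ENNReal.ofReal (Real.exp c⁻¹ * 2 ^ (r + 1) * (m : ℝ) ^ (-(r + 1))) *
        ENNReal.ofReal (x m) ^ k := by
  rcases Nat.eq_zero_or_pos k with rfl | hk
  · rw [Nat.cast_zero, Real.zero_rpow (neg_ne_zero.mpr hr.ne'), ENNReal.ofReal_zero]
    exact zero_le
  have hk0 : (0 : ℝ) ≤ k := Nat.cast_nonneg k
  -- The `k` terms with `k ≤ m < 2 * k` are each at least `k ^ (-(r + 1))`.
  calc ENNReal.ofReal ((k : ℝ) ^ (-r))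
      = ∑ _m ∈ Finset.Ico k (2 * k), ENNReal.ofReal ((k : ℝ) ^ (-(r + 1))) := by
        rw [Finset.sum_const, Nat.card_Ico, two_mul, Nat.add_sub_cancel, nsmul_eq_mul,
          ← ENNReal.ofReal_natCast, ← ENNReal.ofReal_mul hk0,
          ← Real.rpow_one_add' hk0 (by linarith)]
        congr 2; ring
    _ ≤ ∑ m ∈ Finset.Ico k (2 * k),
          ENNReal.ofReal (Real.exp c⁻¹ * 2 ^ (r + 1) * (m : ℝ) ^ (-(r + 1))) *
            ENNReal.ofReal (x m) ^ k := Finset.sum_le_sum fun m hm => by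
        obtain ⟨hkm, hm2⟩ := Finset.mem_Ico.mp hm
        rw [← ENNReal.ofReal_pow (hx0 m), ← ENNReal.ofReal_mul (by positivity)]
        exact ENNReal.ofReal_le_ofReal (rpow_neg_le_rpow_neg_mul_pow hc (by linarith) hk hkm
          hm2.le (hx0 m) (hx1 m) (hxc m))
    _ ≤ _ := ENNReal.sum_le_tsum _

theorem summable_rpow_mul_inv_of_tendsto {p : ℕ → ℝ} {L r σ : ℝ} (hL : L ≠ 0) (hσr : σ < r)
    (hlim : Tendsto (fun n : ℕ => (n : ℝ) ^ σ * p n) atTop (𝓝 L)) :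
    Summable fun m : ℕ => (m : ℝ) ^ (-(r + 1)) * (p m)⁻¹ := by
  have h_power : Summable fun m : ℕ => (m : ℝ) ^ (σ - (r + 1)) :=
    Real.summable_nat_rpow.mpr (by linarith)
  refine summable_of_isBigO_nat h_power ?_
  have h_bounded := (isBigO_refl (fun m : ℕ => (m : ℝ) ^ (σ - (r + 1))) atTop).mul
    ((hlim.inv₀ hL).isBigO_one ℝ)
  refine (h_bounded.congr' ?_ (.of_eq (by simp only [mul_one])))
  filter_upwards [eventually_gt_atTop 0] with m hm
  have hm0 : (0 : ℝ) < m := Nat.cast_pos.mpr hm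
  rw [mul_inv, ← Real.rpow_neg hm0.le, ← mul_assoc, ← Real.rpow_add hm0]
  congr 2; ring

theorem tendsto_zero_of_tendsto_rpow_mul {p : ℕ → ℝ} {L σ : ℝ} (hσ : 0 < σ)
    (hlim : Tendsto (fun n : ℕ => (n : ℝ) ^ σ * p n) atTop (𝓝 L)) :
    Tendsto p atTop (𝓝 0) := by
  have h_power : Tendsto (fun n : ℕ => (n : ℝ) ^ (-σ)) atTop (𝓝 0) :=
    (tendsto_rpow_neg_atTop hσ).comp tendsto_natCast_atTop_atTop
  have h_mul := h_power.mul hlim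
  rw [zero_mul] at h_mul
  refine h_mul.congr' ?_
  filter_upwards [eventually_gt_atTop 0] with n hn
  have hn0 : (0 : ℝ) < n := Nat.cast_pos.mpr hn
  rw [← mul_assoc, ← Real.rpow_add hn0, neg_add_cancel, Real.rpow_zero, one_mul]

end PowerWeights

section Deviation

variable {Ω : Type*} {X : ℕ → ℕ → Ω → ℕ} {Y : ℕ → Ω → ℕ}

/-- The probability that a generation of size `k` is followed by one whose size deviates from
`k` by more than `ε * k`.  The condition `0 < k` removes the ratio `j / 0 = 0`. -/
noncomputable def stepDeviation [MeasurableSpace Ω] (P : Measure Ω) (X : ℕ → ℕ → Ω → ℕ)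
    (Y : ℕ → Ω → ℕ) (ε : ℝ) (k : ℕ) : ℝ≥0∞ :=
  P (nextGen X Y 0 k ⁻¹' {j | 0 < k ∧ ε < |(j : ℝ) / k - 1|})

theorem nextGen_preimage_deviation_subset (ε : ℝ) (n k : ℕ) :
    nextGen X Y n k ⁻¹' {j | 0 < k ∧ ε < |(j : ℝ) / k - 1|} ⊆
      {ω | ε / 2 * k < |∑ i ∈ Finset.range k, (X n i ω : ℝ) - k|} ∪
        {ω | ε / 2 * k < (Y n ω : ℝ)} := by
  rintro ω ⟨hk, hω⟩
  have hk0 : (0 : ℝ) < k := Nat.cast_pos.mpr hk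
  rw [div_sub_one hk0.ne', abs_div, abs_of_pos hk0, lt_div_iff₀ hk0, nextGen, Nat.cast_add,
    Nat.cast_sum, add_sub_right_comm] at hω
  simp only [Set.mem_union, Set.mem_ofPred_eq]
  by_contra! hcon
  linarith [abs_add_le (∑ i ∈ Finset.range k, (X n i ω : ℝ) - k) (Y n ω), hcon.1, hcon.2,
    Nat.abs_cast (R := ℝ) (Y n ω)]

namespace IsGWIInput

variable [MeasurableSpace Ω] {P : Measure Ω} (h : IsGWIInput P X Y)
include h

theorem measure_pos_inter_ratioDeviation (ε : ℝ) (n : ℕ) :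
    P ({ω | 0 < gwi X Y n ω} ∩ ratioDeviation X Y ε n) =
      ∑' k, P (gwi X Y n ⁻¹' {k}) * stepDeviation P X Y ε k := by
  rw [measure_eq_tsum_preimage_singleton_inter (h.measurable_gwi n)]
  refine tsum_congr fun k => ?_
  rw [stepDeviation, ← h.measure_gwi_inter_gwi_succ]
  congr 1
  ext ω
  simp only [ratioDeviation, Set.mem_inter_iff, Set.mem_preimage, Set.mem_singleton_iff,
    Set.mem_ofPred_eq]
  exact and_congr_right fun hk => by rw [hk]

theorem measure_gwi_eq_zero_mul_ennEval_le (m n : ℕ) :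
    P (gwi X Y m ⁻¹' {0}) *
      ennEval (lawSeries P (gwi X Y n)) ((ennEval (lawSeries P (X 0 0)))^[m] 0) ≤
        P (gwi X Y n ⁻¹' {0}) := by
  have := h.isProbabilityMeasure
  have h_maps : Set.MapsTo (ennEval (lawSeries P (X 0 0))) (Set.Iic 1) (Set.Iic 1) :=
    fun x hx => ennEval_lawSeries_le_one (h.measurable_X 0 0) hx
  calc _ = P (gwi X Y (m + n) ⁻¹' {0}) := by
        simp only [← coeff_lawSeries, h.lawSeries_gwi, coeff_zero_immigrationSeries_add]
    _ = P (gwi X Y n ⁻¹' {0}) *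
        ennEval (lawSeries P (gwi X Y m)) ((ennEval (lawSeries P (X 0 0)))^[n] 0) := by
        simp only [add_comm m, ← coeff_lawSeries, h.lawSeries_gwi,
          coeff_zero_immigrationSeries_add]
    _ ≤ _ := mul_le_of_le_one_right' (ennEval_lawSeries_le_one (h.measurable_gwi m)
      (h_maps.iterate n (Set.mem_Iic.mpr zero_le_one)))

theorem monotone_deviation_div (h0 : ∀ n, P (gwi X Y n ⁻¹' {0}) ≠ 0) (ε : ℝ) :
    Monotone fun n => P ({ω | 0 < gwi X Y n ω} ∩ ratioDeviation X Y ε n) /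
      P (gwi X Y n ⁻¹' {0}) := by
  have := h.isProbabilityMeasure
  refine monotone_nat_of_le_succ fun n => ENNReal.div_le_of_le_mul ?_
  rw [← ENNReal.mul_div_right_comm, ENNReal.le_div_iff_mul_le (Or.inl (h0 _))
    (Or.inl (measure_ne_top _ _)), h.measure_pos_inter_ratioDeviation,
    h.measure_pos_inter_ratioDeviation, ← ENNReal.tsum_mul_right, ← ENNReal.tsum_mul_right]
  refine ENNReal.tsum_le_tsum fun k => ?_
  have h_ratio : P (gwi X Y n ⁻¹' {k}) * P (gwi X Y (n + 1) ⁻¹' {0}) ≤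
      P (gwi X Y (n + 1) ⁻¹' {k}) * P (gwi X Y n ⁻¹' {0}) := by
    simpa only [← coeff_lawSeries, h.lawSeries_gwi] using
      coeff_immigrationSeries_mul_coeff_zero_le (lawSeries P (X 0 0)) (lawSeries P (Y 0)) n k
  rw [mul_right_comm, mul_right_comm _ (stepDeviation P X Y ε k)]
  gcongr

theorem exists_stepDeviation_le {r : ℝ} (hr : 1 ≤ r) (hm : ∫ ω, (X 0 0 ω : ℝ) ∂P = 1)
    (hX : Integrable (fun ω => (X 0 0 ω : ℝ) ^ (r + 1)) P)
    (hY : Integrable (fun ω => (Y 0 ω : ℝ) ^ r) P) {ε : ℝ} (hε : 0 < ε) :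
    ∃ C : ℝ, 0 ≤ C ∧ ∀ k : ℕ, stepDeviation P X Y ε k ≤ ENNReal.ofReal (C * (k : ℝ) ^ (-r)) := by
  have := h.isProbabilityMeasure
  let U : ℕ → Ω → ℝ := fun i ω => (X 0 i ω : ℝ)
  have h_cast : Measurable fun j : ℕ => (j : ℝ) := .of_discrete
  have hU : ∀ i, Measurable (U i) := fun i => h_cast.comp (h.measurable_X 0 i)
  have hU2 : MemLp (U 0) 2 P := by
    rw [memLp_two_iff_integrable_sq (hU 0).aestronglyMeasurable]
    simpa only [Real.rpow_two] using
      integrable_natCast_rpow_of_le (h.measurable_X 0 0) two_pos (by linarith) hX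
  obtain ⟨C, hC, hsum⟩ := exists_measureReal_abs_sum_sub_le (P := P) hU
    ((h.iIndepFun_offspring 0).comp (fun _ j => (j : ℝ)) fun _ => h_cast)
    (fun i => (h.identDistrib_X 0 i).comp h_cast) (by linarith : 0 < r) (half_pos hε) hU2
    (by simpa only [U, Nat.abs_cast] using hX)
  simp only [U, hm, mul_one] at hsum
  have hYint : Integrable (fun ω => |(Y 0 ω : ℝ)| ^ r) P := by simpa only [Nat.abs_cast] using hY
  refine ⟨C + (∫ ω, |(Y 0 ω : ℝ)| ^ r ∂P) * (ε / 2) ^ (-r), by positivity, fun k => ?_⟩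
  rcases Nat.eq_zero_or_pos k with rfl | hk
  · simp [stepDeviation]
  have hk0 : (0 : ℝ) < k := Nat.cast_pos.mpr hk
  have hYk := measureReal_lt_le_integral_rpow_mul (by linarith : 0 ≤ r)
    (by positivity : 0 < ε / 2 * k) hYint
  rw [stepDeviation, ← ofReal_measureReal (measure_ne_top P _)]
  refine ENNReal.ofReal_le_ofReal
    ((measureReal_mono (nextGen_preimage_deviation_subset ε 0 k)).trans
      ((measureReal_union_le _ _).trans ((add_le_add (hsum k hk) hYk).trans_eq ?_)))
  rw [Real.mul_rpow (by positivity) hk0.le]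
  ring

end IsGWIInput

end Deviation

section Limit

variable {Ω : Type*} [MeasurableSpace Ω] {P : Measure Ω} {X : ℕ → ℕ → Ω → ℕ} {Y : ℕ → Ω → ℕ}

theorem hasSum_pointMass_mul_of_integral_eq {V : Ω → ℕ} (hV : Measurable V)
    {f : ℕ → ℝ} {s : ℝ} (hf : ∫ ω, f (V ω) ∂P = s) (hs : s ≠ 0) :
    HasSum (fun j => pointMass P V j * f j) s := by
  rw [← hf]
  exact hasSum_pointMass_mul hV (.of_integral_ne_zero (hf.trans_ne hs))

namespace IsGWIInput

variable (h : IsGWIInput P X Y)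
include h

theorem exists_tendsto_deviation_div (h0 : ∀ n, P (gwi X Y n ⁻¹' {0}) ≠ 0) {ε : ℝ} {K : ℝ≥0∞}
    (hK : K ≠ ⊤) (hle : ∀ n, P ({ω | 0 < gwi X Y n ω} ∩ ratioDeviation X Y ε n) ≤
      K * P (gwi X Y n ⁻¹' {0})) :
    ∃ s : ℝ, 0 ≤ s ∧
      Tendsto (fun n => P.real ({ω | 0 < gwi X Y n ω} ∩ ratioDeviation X Y ε n) /
        P.real (gwi X Y n ⁻¹' {0})) atTop (𝓝 s) ∧
      (0 < s ↔ ∃ n, 0 < P ({ω | 0 < gwi X Y n ω} ∩ ratioDeviation X Y ε n)) := by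
  have := h.isProbabilityMeasure
  set ratio : ℕ → ℝ≥0∞ := fun n => P ({ω | 0 < gwi X Y n ω} ∩ ratioDeviation X Y ε n) /
    P (gwi X Y n ⁻¹' {0}) with h_ratio
  have h_sup : ⨆ n, ratio n ≠ ⊤ :=
    ne_top_of_le_ne_top hK (iSup_le fun n => ENNReal.div_le_of_le_mul (hle n))
  refine ⟨(⨆ n, ratio n).toReal, ENNReal.toReal_nonneg, ?_, ?_⟩
  · simpa only [h_ratio, Function.comp_def, ENNReal.toReal_div, measureReal_def] using
      (ENNReal.tendsto_toReal h_sup).comp (tendsto_atTop_iSup (h.monotone_deviation_div h0 ε))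
  · rw [ENNReal.toReal_pos_iff, and_iff_left h_sup.lt_top, lt_iSup_iff]
    refine exists_congr fun n => ?_
    rw [ENNReal.div_pos_iff, and_iff_left (measure_ne_top _ _), pos_iff_ne_zero]

theorem measureReal_gwi_eq_zero (n : ℕ) :
    P.real (gwi X Y n ⁻¹' {0}) = ∏ k ∈ Finset.range n,
      genFun (pointMass P (Y 0)) ((genFun (pointMass P (X 0 0)))^[k] 0) := by
  have := h.isProbabilityMeasure
  have hX := h.measurable_X 0 0
  have hY := h.measurable_Y 0
  have h_iter : ∀ k, (genFun (pointMass P (X 0 0)))^[k] 0 ∈ Set.Icc (0 : ℝ) 1 := fun k =>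
    (mapsTo_genFun_Icc pointMass_nonneg (hasSum_pointMass hX)).iterate k (by simp)
  rw [measureReal_def, ← coeff_lawSeries, h.lawSeries_gwi, ← ennEval_zero,
    ennEval_immigrationSeries, ENNReal.toReal_prod]
  refine Finset.prod_congr rfl fun k _ => ?_
  rw [iterate_ennEval_lawSeries hX, ennEval_lawSeries hY (h_iter k), ENNReal.toReal_ofReal
    (mapsTo_genFun_Icc pointMass_nonneg (hasSum_pointMass hY) (h_iter k)).1]

theorem measureReal_gwi_eq_zero_pos (hb0 : 0 < pointMass P (Y 0) 0) (n : ℕ) :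
    0 < P.real (gwi X Y n ⁻¹' {0}) := by
  have := h.isProbabilityMeasure
  rw [h.measureReal_gwi_eq_zero]
  refine Finset.prod_pos fun k _ => hb0.trans_le (coeff_zero_le_genFun pointMass_nonneg
    (hasSum_pointMass (h.measurable_Y 0)) ?_)
  exact (mapsTo_genFun_Icc pointMass_nonneg (hasSum_pointMass (h.measurable_X 0 0))).iterate k
    (by simp)

theorem measure_gwi_eq_zero_ne_zero (hb0 : 0 < pointMass P (Y 0) 0) (n : ℕ) :
    P (gwi X Y n ⁻¹' {0}) ≠ 0 :=
  (ENNReal.toReal_pos_iff.mp (h.measureReal_gwi_eq_zero_pos hb0 n)).1.ne'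

theorem exists_pos_measure_deviation {γ : ℝ} (hγ0 : 0 < γ)
    (hγ : ∫ ω, (X 0 0 ω : ℝ) * (X 0 0 ω - 1) / 2 ∂P = γ) (hY : 0 < ∫ ω, (Y 0 ω : ℝ) ∂P)
    {ε : ℝ} (hε : ε ≤ 1) :
    ∃ n : ℕ, 0 < P ({ω | 0 < gwi X Y n ω} ∩ ratioDeviation X Y ε n) := by
  have := h.isProbabilityMeasure
  obtain ⟨j, hj, haj⟩ := exists_two_le_pos pointMass_nonneg hγ0
    (hasSum_pointMass_mul_of_integral_eq (f := fun j => (j : ℝ) * (j - 1) / 2)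
      (h.measurable_X 0 0) hγ hγ0.ne')
  obtain ⟨k, hbk_mul⟩ := exists_pos_of_hasSum_pos
    (hasSum_pointMass_mul_of_integral_eq (f := Nat.cast) (h.measurable_Y 0) rfl hY.ne') hY
  have hk : 0 < k := Nat.cast_pos.mp (pos_of_mul_pos_right hbk_mul (pointMass_nonneg k))
  have hbk : P (Y 0 ⁻¹' {k}) ≠ 0 := (ENNReal.toReal_ne_zero.mp (left_ne_zero_of_mul hbk_mul.ne')).1
  have h_next : P (nextGen X Y 0 k ⁻¹' {j * k + k}) ≠ 0 := by
    rw [← coeff_lawSeries, h.lawSeries_nextGen]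
    refine ((ENNReal.mul_pos (pow_ne_zero k ?_) ?_).trans_le ((mul_le_mul_left
      (coeff_pow_le_coeff_pow (lawSeries P (X 0 0)) j k) _).trans
        (coeff_mul_coeff_le_coeff_mul _ (lawSeries P (Y 0)) (j * k) k))).ne'
    · rw [coeff_lawSeries]; exact (ENNReal.toReal_ne_zero.mp haj.ne').1
    · rwa [coeff_lawSeries]
  have h_step : nextGen X Y 0 k ⁻¹' {j * k + k} ⊆
      nextGen X Y 0 k ⁻¹' {j | 0 < k ∧ ε < |(j : ℝ) / k - 1|} := by
    refine Set.preimage_mono (Set.singleton_subset_iff.mpr ⟨hk, ?_⟩)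
    have hk0 : (k : ℝ) ≠ 0 := Nat.cast_ne_zero.mpr hk.ne'
    rw [Nat.cast_add, Nat.cast_mul, add_div, mul_div_cancel_right₀ _ hk0, div_self hk0,
      add_sub_cancel_right, Nat.abs_cast]
    exact hε.trans_lt (Nat.one_lt_cast.mpr hj)
  refine ⟨1, ?_⟩
  rw [h.measure_pos_inter_ratioDeviation]
  refine (ENNReal.mul_pos ?_ ?_).trans_le (ENNReal.le_tsum k)
  · have h_one : gwi X Y 1 = Y 0 := by ext ω; simp [gwi]
    rwa [h_one]
  · exact ((pos_iff_ne_zero.mpr h_next).trans_le (measure_mono h_step)).ne'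

variable (hb0 : 0 < pointMass P (Y 0) 0) (hm : ∫ ω, (X 0 0 ω : ℝ) ∂P = 1)
  {γ : ℝ} (hγ0 : 0 < γ) (hγ : ∫ ω, (X 0 0 ω : ℝ) * (X 0 0 ω - 1) / 2 ∂P = γ)
  {r : ℝ} (hr : 1 < r) (hX : Integrable (fun ω => (X 0 0 ω : ℝ) ^ (r + 1)) P)
  (hY : Integrable (fun ω => (Y 0 ω : ℝ) ^ r) P)
include hb0 hm hγ0 hγ

include hr hX hY in
theorem exists_tendsto_rpow_mul_measureReal_gwi_eq_zero {β : ℝ}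
    (hβ : ∫ ω, (Y 0 ω : ℝ) ∂P = β) :
    ∃ L : ℝ, 0 < L ∧
      Tendsto (fun n : ℕ => (n : ℝ) ^ (β / γ) * P.real (gwi X Y n ⁻¹' {0})) atTop (𝓝 L) := by
  have := h.isProbabilityMeasure
  have hX0 := h.measurable_X 0 0
  have hY0 := h.measurable_Y 0
  have hη : min 1 (r - 1) ∈ Set.Ioc (0 : ℝ) 1 := ⟨lt_min one_pos (by linarith), min_le_left _ _⟩
  have hηr : min 1 (r - 1) ≤ r - 1 := min_le_right _ _
  have hXη := integrable_natCast_rpow_of_le hX0 (by linarith [hη.1])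
    (by linarith : 2 + min 1 (r - 1) ≤ r + 1) hX
  have hYη := integrable_natCast_rpow_of_le hY0 (by linarith [hη.1])
    (by linarith : 1 + min 1 (r - 1) ≤ r) hY
  have hY1 : Integrable (fun ω => (Y 0 ω : ℝ)) P := by
    simpa only [Real.rpow_one] using integrable_natCast_rpow_of_le hY0 one_pos hr.le hY
  simp only [h.measureReal_gwi_eq_zero]
  exact exists_tendsto_rpow_mul_prod_genFun pointMass_nonneg (hasSum_pointMass hX0)
    (hasSum_pointMass_mul_of_integral_eq (f := Nat.cast) hX0 hm one_ne_zero) hγ0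
    (hasSum_pointMass_mul_of_integral_eq (f := fun j => (j : ℝ) * (j - 1) / 2) hX0 hγ hγ0.ne')
    hη (hasSum_pointMass_mul (f := fun j => (j : ℝ) ^ (2 + min 1 (r - 1))) hX0 hXη).summable
    pointMass_nonneg (hasSum_pointMass hY0) hb0
    (hβ ▸ hasSum_pointMass_mul (f := Nat.cast) hY0 hY1)
    (hasSum_pointMass_mul (f := fun j => (j : ℝ) ^ (1 + min 1 (r - 1))) hY0 hYη).summable

/-- The function `k ^ (-s)` is dominated by a combination of the powers `x ^ k` at the points
`x = A^m (0)`, where the generating function of `Z_n` is at most `P (Z_n = 0) / P (Z_m = 0)`. -/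
theorem exists_tsum_measure_gwi_mul_rpow_neg_le {σ s L : ℝ} (hs : 0 < s) (hσs : σ < s)
    (hL : L ≠ 0) (hlim : Tendsto (fun n : ℕ => (n : ℝ) ^ σ * P.real (gwi X Y n ⁻¹' {0}))
      atTop (𝓝 L)) :
    ∃ K : ℝ≥0∞, K ≠ ⊤ ∧ ∀ n, ∑' k : ℕ, P (gwi X Y n ⁻¹' {k}) * ENNReal.ofReal ((k : ℝ) ^ (-s)) ≤
      K * P (gwi X Y n ⁻¹' {0}) := by
  have := h.isProbabilityMeasure
  have hX0 := h.measurable_X 0 0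
  have ha := hasSum_pointMass (P := P) hX0
  have hγ_sum := hasSum_pointMass_mul_of_integral_eq (f := fun j => (j : ℝ) * (j - 1) / 2) hX0
    hγ hγ0.ne'
  obtain ⟨c, hc, hle⟩ := exists_one_sub_iterate_genFun_le pointMass_nonneg ha
    (hasSum_pointMass_mul_of_integral_eq (f := Nat.cast) hX0 hm one_ne_zero) hγ0 hγ_sum
  have hmem := iterate_genFun_zero_mem_Ico pointMass_nonneg ha hγ0 hγ_sum
  have hpos : ∀ m, P (gwi X Y m ⁻¹' {0}) ≠ 0 := h.measure_gwi_eq_zero_ne_zero hb0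
  let w : ℕ → ℝ := fun m => Real.exp c⁻¹ * 2 ^ (s + 1) * (m : ℝ) ^ (-(s + 1))
  let x : ℕ → ℝ≥0∞ := fun m => (ennEval (lawSeries P (X 0 0)))^[m] 0
  have hw : ∀ k : ℕ, ENNReal.ofReal ((k : ℝ) ^ (-s)) ≤ ∑' m, ENNReal.ofReal (w m) * x m ^ k := by
    intro k
    simpa only [w, x, iterate_ennEval_lawSeries hX0] using ofReal_rpow_neg_le_tsum_mul_pow hc hs
      (fun m => (hmem m).1) (fun m => (hmem m).2.le) hle k
  refine ⟨∑' m, ENNReal.ofReal (w m) * (P (gwi X Y m ⁻¹' {0}))⁻¹, ?_, fun n => ?_⟩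
  · have h_summable := (summable_rpow_mul_inv_of_tendsto hL hσs hlim).mul_left
      (Real.exp c⁻¹ * 2 ^ (s + 1))
    convert h_summable.tsum_ofReal_ne_top using 4 with m
    rw [← mul_assoc, ENNReal.ofReal_mul (p := Real.exp c⁻¹ * 2 ^ (s + 1) * (m : ℝ) ^ (-(s + 1)))
      (by positivity), ENNReal.ofReal_inv_of_pos
      (h.measureReal_gwi_eq_zero_pos hb0 m), ofReal_measureReal]
  have h_eval : ∀ m, ennEval (lawSeries P (gwi X Y n)) (x m) ≤
      (P (gwi X Y m ⁻¹' {0}))⁻¹ * P (gwi X Y n ⁻¹' {0}) := fun m => by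
    rw [← ENNReal.div_eq_inv_mul, ENNReal.le_div_iff_mul_le (Or.inl (hpos m))
      (Or.inl (measure_ne_top _ _)), mul_comm]
    exact h.measure_gwi_eq_zero_mul_ennEval_le m n
  simp only [← coeff_lawSeries P (gwi X Y n)] at h_eval ⊢
  refine (tsum_coeff_mul_le_tsum_mul_ennEval _ hw).trans ?_
  rw [← ENNReal.tsum_mul_right]
  refine ENNReal.tsum_le_tsum fun m => ?_
  rw [mul_assoc]
  exact mul_le_mul_right (h_eval m) _

include hr hX hY in
theorem exists_measure_deviation_le {σ L : ℝ} (hσr : σ < r) (hL : L ≠ 0)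
    (hlim : Tendsto (fun n : ℕ => (n : ℝ) ^ σ * P.real (gwi X Y n ⁻¹' {0})) atTop (𝓝 L))
    {ε : ℝ} (hε : 0 < ε) :
    ∃ K : ℝ≥0∞, K ≠ ⊤ ∧ ∀ n, P ({ω | 0 < gwi X Y n ω} ∩ ratioDeviation X Y ε n) ≤
      K * P (gwi X Y n ⁻¹' {0}) := by
  obtain ⟨C, hC, hstep⟩ := h.exists_stepDeviation_le hr.le hm hX hY hε
  obtain ⟨K, hK, htail⟩ :=
    h.exists_tsum_measure_gwi_mul_rpow_neg_le hb0 hm hγ0 hγ (by linarith) hσr hL hlim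
  refine ⟨ENNReal.ofReal C * K, ENNReal.mul_ne_top ENNReal.ofReal_ne_top hK, fun n => ?_⟩
  calc P ({ω | 0 < gwi X Y n ω} ∩ ratioDeviation X Y ε n)
      ≤ ∑' k : ℕ, P (gwi X Y n ⁻¹' {k}) * ENNReal.ofReal (C * (k : ℝ) ^ (-r)) := by
        rw [h.measure_pos_inter_ratioDeviation]
        gcongr with k
        exact hstep k
    _ = ENNReal.ofReal C *
        ∑' k : ℕ, P (gwi X Y n ⁻¹' {k}) * ENNReal.ofReal ((k : ℝ) ^ (-r)) := by
        simp only [ENNReal.ofReal_mul hC, ← ENNReal.tsum_mul_left, mul_left_comm]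
    _ ≤ ENNReal.ofReal C * K * P (gwi X Y n ⁻¹' {0}) := by
        rw [mul_assoc]
        gcongr
        exact htail n

omit hb0 hm hγ0 hγ in
theorem cond_real_ratioDeviation (ε : ℝ) (n : ℕ) :
    (cond P {ω | 0 < gwi X Y n ω}).real (ratioDeviation X Y ε n) =
      (1 - P.real (gwi X Y n ⁻¹' {0}))⁻¹ *
        P.real ({ω | 0 < gwi X Y n ω} ∩ ratioDeviation X Y ε n) := by
  have := h.isProbabilityMeasure
  have h_compl : {ω | 0 < gwi X Y n ω} = (gwi X Y n ⁻¹' {0})ᶜ := by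
    ext ω; simp [Nat.pos_iff_ne_zero]
  have h_zero : MeasurableSet (gwi X Y n ⁻¹' {0}) := h.measurable_gwi n (measurableSet_singleton 0)
  rw [h_compl, measureReal_def, cond_apply h_zero.compl, ENNReal.toReal_mul, ENNReal.toReal_inv,
    ← measureReal_def, ← measureReal_def, probReal_compl_eq_one_sub h_zero]

end IsGWIInput

theorem corollary3p2_general (hXY : IsGWIInput P X Y) (hb0 : 0 < pointMass P (Y 0) 0)
    {β γ : ℝ} (hβ0 : 0 < β) (hγ0 : 0 < γ) (hm : ∫ ω, (X 0 0 ω : ℝ) ∂P = 1)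
    (hγ : ∫ ω, (X 0 0 ω : ℝ) * (X 0 0 ω - 1) / 2 ∂P = γ) (hβ : ∫ ω, (Y 0 ω : ℝ) ∂P = β)
    {r : ℝ} (hr : max (β / γ) 1 < r) (hX : Integrable (fun ω => (X 0 0 ω : ℝ) ^ (r + 1)) P)
    (hY : Integrable (fun ω => (Y 0 ω : ℝ) ^ r) P) {ε : ℝ} (hε : 0 < ε) :
    ∃ q : ℝ, 0 ≤ q ∧
      Tendsto (fun n : ℕ => (n : ℝ) ^ (β / γ) *
        (cond P {ω | 0 < gwi X Y n ω}).real (ratioDeviation X Y ε n)) atTop (𝓝 q) ∧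
      (0 < q ↔ ∃ n : ℕ, 0 < P ({ω | 0 < gwi X Y n ω} ∩ ratioDeviation X Y ε n)) ∧
      (ε ≤ 1 → 0 < q) := by
  have := hXY.isProbabilityMeasure
  obtain ⟨hσr, hr1⟩ := max_lt_iff.mp hr
  obtain ⟨L, hL, hlim⟩ := hXY.exists_tendsto_rpow_mul_measureReal_gwi_eq_zero hb0 hm hγ0 hγ hr1
    hX hY hβ
  obtain ⟨K, hK, hle⟩ := hXY.exists_measure_deviation_le hb0 hm hγ0 hγ hr1 hX hY hσr hL.ne'
    hlim hε
  have hzero := tendsto_zero_of_tendsto_rpow_mul (div_pos hβ0 hγ0) hlim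
  obtain ⟨s, hs0, hs, hs_pos⟩ := hXY.exists_tendsto_deviation_div
    (hXY.measure_gwi_eq_zero_ne_zero hb0) hK hle
  have hq : 0 < L * s ↔ ∃ n, 0 < P ({ω | 0 < gwi X Y n ω} ∩ ratioDeviation X Y ε n) := by
    rw [mul_pos_iff_of_pos_left hL, hs_pos]
  refine ⟨L * s, mul_nonneg hL.le hs0, ?_, hq, fun hε1 => hq.mpr
    (hXY.exists_pos_measure_deviation hγ0 hγ (hβ0.trans_eq hβ.symm) hε1)⟩
  have h_limit := ((hzero.const_sub 1).inv₀ (by norm_num)).mul (hlim.mul hs)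
  rw [sub_zero, inv_one, one_mul] at h_limit
  refine h_limit.congr fun n => ?_
  have h_ne : P.real (gwi X Y n ⁻¹' {0}) ≠ 0 :=
    (hXY.measureReal_gwi_eq_zero_pos hb0 n).ne'
  rw [hXY.cond_real_ratioDeviation]
  field_simp

namespace ConditionH

variable {β γ : ℝ} (hH : ConditionH P X Y β γ)
include hH

theorem integral_immigration (hY0 : Measurable (Y 0))
    (hY : Integrable (fun ω => (Y 0 ω : ℝ)) P) : ∫ ω, (Y 0 ω : ℝ) ∂P = β :=
  tendsto_nhds_unique (tendsto_deriv_genFun pointMass_nonneg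
    (hasSum_pointMass_mul (f := Nat.cast) hY0 hY)) hH.tendsto_beta

theorem integral_offspring_mul_sub_one (hX0 : Measurable (X 0 0))
    (hX : Integrable (fun ω => (X 0 0 ω : ℝ) ^ (2 : ℝ)) P) :
    ∫ ω, (X 0 0 ω : ℝ) * (X 0 0 ω - 1) / 2 ∂P = γ := by
  have hX1 := hasSum_pointMass_mul_of_integral_eq (f := Nat.cast) hX0 hH.mean_offspring
    one_ne_zero
  have hX2 : Integrable (fun ω => (X 0 0 ω : ℝ) * (X 0 0 ω - 1)) P := by
    simp only [Real.rpow_two] at hX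
    refine (hX.sub (.of_integral_ne_zero (hH.mean_offspring.trans_ne one_ne_zero))).congr
      (ae_of_all _ fun ω => ?_)
    simp only [Pi.sub_apply]
    ring
  rw [integral_div, div_eq_inv_mul, ← one_div]
  exact tendsto_nhds_unique ((tendsto_iteratedDeriv_two_genFun pointMass_nonneg hX1
    (hasSum_pointMass_mul (f := fun j => (j : ℝ) * (j - 1)) hX0 hX2)).const_mul _)
    hH.tendsto_gamma

end ConditionH

end Limit

theorem corollary3p2 {Ω : Type*} [MeasurableSpace Ω] (P : Measure Ω) [IsProbabilityMeasure P]
    (X : ℕ → ℕ → Ω → ℕ) (Y : ℕ → Ω → ℕ) (hXY : IsGWIInput P X Y)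
    (β γ : ℝ) (hH : ConditionH P X Y β γ)
    (r δ : ℝ) (hδ : 0 < δ) (hr : max (β / γ) 1 < r)
    (hX : Integrable (fun ω => (X 0 0 ω : ℝ) ^ (2 * r + δ)) P)
    (hY : Integrable (fun ω => (Y 0 ω : ℝ) ^ r) P)
    (ε : ℝ) (hε : 0 < ε) :
    ∃ q : ℝ, 0 ≤ q ∧
      Tendsto (fun n : ℕ => (n : ℝ) ^ (β / γ) *
          (ProbabilityTheory.cond P {ω | 0 < gwi X Y n ω}).real (ratioDeviation X Y ε n))
        atTop (𝓝 q) ∧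
      (0 < q ↔ ∃ n : ℕ, 0 < P ({ω | 0 < gwi X Y n ω} ∩ ratioDeviation X Y ε n)) ∧
      (ε ≤ 1 → 0 < q) := by
  have hr1 : 1 < r := (le_max_right _ _).trans_lt hr
  have hX0 := hXY.measurable_X 0 0
  have hX2 := integrable_natCast_rpow_of_le hX0 two_pos (by linarith) hX
  have hXr := integrable_natCast_rpow_of_le hX0 (by linarith) (by linarith : r + 1 ≤ _) hX
  have hY1 := integrable_natCast_rpow_of_le (hXY.measurable_Y 0) one_pos hr1.le hY
  simp only [Real.rpow_one] at hY1
  exact corollary3p2_general hXY hH.b_zero_pos hH.beta_pos hH.gamma_pos hH.mean_offspring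
    (hH.integral_offspring_mul_sub_one hX0 hX2)
    (hH.integral_immigration (hXY.measurable_Y 0) hY1) hr hXr hY hε
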